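/- Let $N\ge 3$ be prime, let $q\ge 2$ be an integer with $N\mid q$, and let $\Gamma_0(N),\Gamma_0(q)\le \mathrm{PSL}_2(\mathbb Z)$ be the Hecke congruence groups, $Y_0(N)=\Gamma_0(N)\backslash\mathbb H$. Let $\psi:(\mathbb Z/q\mathbb Z)^\times\to\Gamma_0(q)$ be a double coset embedding of level $q$, that is, a map with $\psi(a)\infty\equiv \tfrac aq \bmod 1$ and $|\mathrm{tr}\,\psi(a)|>2$ for all $a$; here $\mathrm{tr}\,\psi(a)$ is the trace of the matrix representing $\psi(a)$ whose lower left entry is positive. For $a\in(\mathbb Z/q\mathbb Z)^\times$ let $[\mathcal C_a^\psi(N)]\in H_1(Y_0(N),\mathbb Z)$ be the homology class of the oriented closed geodesic on $Y_0(N)$ associated to the $\Gamma_0(N)$-conjugacy class of $\psi(a)$ (the projection of the geodesic segment from $w$ to $\psi(a)w$, with $w$ on the semicircle fixed by $\psi(a)$). Let $\omega_E(N)$ be the Eisenstein class, i.e. the cohomology class of the form $E_{2,N}(z)\,dz$, where $$E_{2,N}(z)=\frac{N E_2^\ast(Nz)-E_2^\ast(z)}{N-1},\qquad E_2^\ast(z)=1-\frac{3}{\pi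 y}-24\sum_{n\ge1}\Big(\sum_{d\mid n}d\Big)e^{2\pi i n z},\quad y=\operatorname{Im}z,$$ and let $\langle\cdot,\cdot\rangle_{\mathrm{cap}}$ be the cap product pairing, given by integration of the form over cycles. Let $\chi$ be a Dirichlet character mod $q$, induced by the primitive character $\chi^\ast$ mod $\mathbf c(\chi)$, and put $q^\ast=q/\mathbf c(\chi)$. Then $$\sum_{a\in(\mathbb Z/q\mathbb Z)^\times}\overline{\chi(a)}\,\big\langle[\mathcal C_a^\psi(N)],\omega_E(N)\big\rangle_{\mathrm{cap}}=\frac{6(1-\chi(-1))}{\pi^2}\,\frac{|\chi^\ast(N)-1|^2}{N-1}\,|L(1,\chi^\ast)|^2\,\mathbf c(\chi)\,\nu\!\Big(\chi^\ast,\tfrac{q^\ast}{(q^\ast,N^\infty)}\Big)+\sum_{a\in(\mathbb Z/q\mathbb Z)^\times}\overline{\chi(a)}\,\frac{\mathrm{tr}\,\psi(a)}{q},$$ where the first term on the right is interpreted as $0$ if $\chi$ is principal, and this first term is always a nonnegative real number. Here $(m,N^\infty)$ is the largest power of $N$ dividing $m$, and, with $\mu$ the Möbius function, $$\nu(\chi^\ast,n)=\sum_{n_1n_2n_3=n}\mu(n_1)\overline{\chi^\ast(n_1)}\,\mu(n_2)\chi^\ast(n_2)\sum_{d\mid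 n_3}d .$$ -/

import Mathlib

open UpperHalfPlane CongruenceSubgroup MeasureTheory
open scoped MatrixGroups ContDiff ComplexConjugate

noncomputable section

namespace EisHom

/-! ## The modular curve `Y₀(N)` and its homology -/

/-- The open modular curve `Y₀(N) = Γ₀(N) \ ℍ`. -/
abbrev Y0 (N : ℕ) : Type := MulAction.orbitRel.Quotient (Gamma0 N) ℍ

/-- The projection `ℍ → Y₀(N)`. -/
def proj (N : ℕ) (z : ℍ) : Y0 N := Quotient.mk _ z

lemma proj_eq_iff {N : ℕ} {z w : ℍ} : proj N z = proj N w ↔ ∃ γ ∈ Gamma0 N, z = γ • w := by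
  unfold proj
  rw [Quotient.eq]
  change z ∈ MulAction.orbit (Gamma0 N) w ↔ _
  constructor
  · rintro ⟨⟨γ, hγ⟩, h⟩
    exact ⟨γ, hγ, h.symm⟩
  · rintro ⟨γ, hγ, h⟩
    exact ⟨⟨γ, hγ⟩, h.symm⟩

/-- `f` is a smooth lift to `ℍ` of the map `s : Δⁿ → Y₀(N)`: it is smooth on a neighbourhood of the
standard simplex and its projection to `Y₀(N)` is `s`. -/
def IsSmoothLift (N : ℕ) {n : ℕ} (s : stdSimplex ℝ (Fin (n + 1)) → Y0 N)
    (f : (Fin (n + 1) → ℝ) → ℍ) : Prop :=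
  (∃ U : Set (Fin (n + 1) → ℝ), IsOpen U ∧ stdSimplex ℝ (Fin (n + 1)) ⊆ U ∧
    ContDiffOn ℝ ∞ (fun x => (f x : ℂ)) U) ∧
  ∀ x : stdSimplex ℝ (Fin (n + 1)), s x = proj N (f x)

/-- Smooth singular `n`-simplices of `Y₀(N)`, in the orbifold sense: the maps `Δⁿ → Y₀(N)` that lift
to a smooth map into `ℍ`. -/
def SmoothSimplex (N n : ℕ) : Type :=
  {s : stdSimplex ℝ (Fin (n + 1)) → Y0 N // ∃ f, IsSmoothLift N s f}

lemma isSmoothLift_face {N n : ℕ} {s : stdSimplex ℝ (Fin (n + 2)) → Y0 N}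
    {f : (Fin (n + 2) → ℝ) → ℍ} (h : IsSmoothLift N s f) (i : Fin (n + 2)) :
    IsSmoothLift N (fun x => s (stdSimplex.map i.succAbove x))
      (fun x => f (FunOnFinite.linearMap ℝ ℝ i.succAbove x)) := by
  obtain ⟨⟨U, hU, hsub, hf⟩, hs⟩ := h
  have hcont := FunOnFinite.continuous_linearMap ℝ ℝ i.succAbove
  refine ⟨⟨_, hU.preimage hcont, fun x hx => hsub ?_, ?_⟩, fun x => hs _⟩
  · exact stdSimplex.image_linearMap _ ⟨x, hx, rfl⟩
  · exact hf.comp (LinearMap.toContinuousLinearMap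
      (FunOnFinite.linearMap ℝ ℝ i.succAbove)).contDiff.contDiffOn (fun x hx => hx)

/-- The `i`-th face of a simplex. -/
def face {N n : ℕ} (s : SmoothSimplex N (n + 1)) (i : Fin (n + 2)) : SmoothSimplex N n :=
  ⟨fun x => s.1 (stdSimplex.map i.succAbove x),
    let ⟨_, hf⟩ := s.2
    ⟨_, isSmoothLift_face hf i⟩⟩

/-- Smooth singular `n`-chains of `Y₀(N)` with integral coefficients. -/
abbrev Chain (N n : ℕ) : Type := SmoothSimplex N n →₀ ℤ

/-- The boundary operator `∂ s = ∑ᵢ (-1)ⁱ (i-th face of s)`. -/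
def boundary (N n : ℕ) : Chain N (n + 1) →ₗ[ℤ] Chain N n :=
  Finsupp.linearCombination ℤ fun s =>
    ∑ i : Fin (n + 2), (-1 : ℤ) ^ (i : ℕ) • Finsupp.single (face s i) 1

lemma face_face {N n : ℕ} (s : SmoothSimplex N (n + 2)) {i i' : Fin (n + 3)} {j j' : Fin (n + 2)}
    (h : i.succAbove ∘ j.succAbove = i'.succAbove ∘ j'.succAbove) :
    face (face s i) j = face (face s i') j' := by
  refine Subtype.ext (funext fun x => ?_)
  change s.1 _ = s.1 _
  rw [stdSimplex.map_comp_apply, stdSimplex.map_comp_apply]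
  exact congrArg (fun k => s.1 (stdSimplex.map k x)) h

lemma boundary_boundary (N : ℕ) (x : Chain N 2) : boundary N 0 (boundary N 1 x) = 0 := by
  suffices h : (boundary N 0).comp (boundary N 1) = 0 from LinearMap.congr_fun h x
  refine Finsupp.lhom_ext' fun s => LinearMap.ext_ring ?_
  have h1 : face (face s 1) 0 = face (face s 0) 0 :=
    face_face s (by ext k; fin_cases k; rfl)
  have h2 : face (face s 2) 0 = face (face s 0) 1 :=
    face_face s (by ext k; fin_cases k; rfl)
  have h3 : face (face s 2) 1 = face (face s 1) 1 :=
    face_face s (by ext k; fin_cases k; rfl)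
  have key : ∀ i : Fin 3, boundary N 0 (Finsupp.single (face s i) 1) =
      Finsupp.single (face (face s i) 0) 1 - Finsupp.single (face (face s i) 1) 1 := by
    intro i
    simp only [boundary, Finsupp.linearCombination_single, one_smul]
    refine (Fin.sum_univ_two _).trans ?_
    simp [sub_eq_add_neg]
  have key2 : boundary N 1 (Finsupp.single s 1) = Finsupp.single (face s 0) 1 -
      Finsupp.single (face s 1) 1 + Finsupp.single (face s 2) 1 := by
    simp only [boundary, Finsupp.linearCombination_single, one_smul]
    refine (Fin.sum_univ_three _).trans ?_
    simp [sub_eq_add_neg]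
  change boundary N 0 (boundary N 1 (Finsupp.single s 1)) = 0
  rw [key2, map_add, map_sub]
  refine (congrArg₂ _ (congrArg₂ _ (key 0) (key 1)) (key 2)).trans ?_
  rw [h1, h2, h3]
  abel

/-- Singular `1`-cycles. -/
abbrev Cycles (N : ℕ) : Submodule ℤ (Chain N 1) := LinearMap.ker (boundary N 0)

/-- The first homology group `H₁(Y₀(N), ℤ)`: cycles modulo boundaries. -/
abbrev H1 (N : ℕ) : Type :=
  Cycles N ⧸ (LinearMap.range (boundary N 1)).submoduleOf (Cycles N)

/-- The first cohomology group `H¹(Y₀(N), ℂ)`, as the dual of `H₁(Y₀(N), ℤ)`. -/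
abbrev H1dual (N : ℕ) : Type := H1 N →ₗ[ℤ] ℂ

/-- The cap product pairing between homology and cohomology. -/
def capPairing {N : ℕ} (v : H1 N) (c : H1dual N) : ℂ := c v

/-! ## Integration of invariant holomorphic `1`-forms -/

/-- `g(z) dz` is a holomorphic `1`-form on `ℍ` that is invariant under `Γ₀(N)`. -/
structure InvariantForm (N : ℕ) (g : ℍ → ℂ) : Prop where
  holo : DifferentiableOn ℂ (fun z : ℂ => g (ofComplex z)) {z : ℂ | 0 < z.im}
  inv : ∀ γ ∈ Gamma0 N, ∀ z : ℍ, g (γ • z) = denom γ z ^ 2 * g z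

/-- The affine parametrization `t ↦ (1 - t) e₀ + t e₁` of `Δ¹`. -/
def edge (t : ℝ) : Fin 2 → ℝ := ![1 - t, t]

/-- `∫ g(z) dz` along the path `t ↦ f((1 - t) e₀ + t e₁)`, `0 ≤ t ≤ 1`, in `ℍ`. -/
def lineIntegral (g : ℍ → ℂ) (f : (Fin 2 → ℝ) → ℍ) : ℂ :=
  ∫ t in (0 : ℝ)..1, g (f (edge t)) * deriv (fun u : ℝ => (f (edge u) : ℂ)) t

/-- The integral of the `1`-form on `Y₀(N)` induced by `g(z) dz` along a smooth `1`-simplex. By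
`simplexIntegral_eq` below, it can be computed with any smooth lift. -/
def simplexIntegral (N : ℕ) (g : ℍ → ℂ) (s : SmoothSimplex N 1) : ℂ :=
  lineIntegral g s.2.choose

lemma edge_mem {t : ℝ} (ht : t ∈ Set.Icc (0 : ℝ) 1) : edge t ∈ stdSimplex ℝ (Fin 2) := by
  refine ⟨?_, by simp [edge]⟩
  intro i
  fin_cases i
  · simpa [edge] using ht.2
  · simpa [edge] using ht.1

lemma contDiff_edge : ContDiff ℝ ∞ edge := by
  refine contDiff_pi.2 fun i => ?_
  fin_cases i
  · exact contDiff_const.sub contDiff_id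
  · exact contDiff_id

lemma IsSmoothLift.path {N : ℕ} {s : stdSimplex ℝ (Fin 2) → Y0 N} {f : (Fin 2 → ℝ) → ℍ}
    (h : IsSmoothLift N s f) : ∃ V : Set ℝ, IsOpen V ∧ Set.Icc 0 1 ⊆ V ∧
      ContDiffOn ℝ ∞ (fun t => (f (edge t) : ℂ)) V := by
  obtain ⟨⟨U, hU, hsub, hf⟩, -⟩ := h
  exact ⟨edge ⁻¹' U, hU.preimage contDiff_edge.continuous, fun t ht => hsub (edge_mem ht),
    hf.comp contDiff_edge.contDiffOn fun _ h => h⟩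

lemma IsSmoothLift.hasDerivAt {N : ℕ} {s : stdSimplex ℝ (Fin 2) → Y0 N} {f : (Fin 2 → ℝ) → ℍ}
    (h : IsSmoothLift N s f) {t : ℝ} (ht : t ∈ Set.Icc (0 : ℝ) 1) :
    HasDerivAt (fun u : ℝ => (f (edge u) : ℂ)) (deriv (fun u : ℝ => (f (edge u) : ℂ)) t) t := by
  obtain ⟨V, hV, hsub, hf⟩ := h.path
  exact ((hf.differentiableOn (by simp)).differentiableAt (hV.mem_nhds (hsub ht))).hasDerivAt

lemma InvariantForm.exists_primitive {N : ℕ} {g : ℍ → ℂ} (hg : InvariantForm N g) :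
    ∃ G : ℂ → ℂ, ∀ z : ℍ, HasDerivAt G (g z) z := by
  have hopen : IsOpen {z : ℂ | 0 < z.im} := isOpen_lt continuous_const Complex.continuous_im
  obtain ⟨G, hG⟩ := (convex_halfSpace_im_gt 0).exists_forall_hasDerivWithinAt hg.holo
  refine ⟨G, fun z => ?_⟩
  have := (hG z z.im_pos).hasDerivAt (hopen.mem_nhds z.im_pos)
  simpa using this

lemma InvariantForm.lineIntegral_eq {N : ℕ} {g : ℍ → ℂ} (hg : InvariantForm N g) {G : ℂ → ℂ}
    (hG : ∀ z : ℍ, HasDerivAt G (g z) z) {s : stdSimplex ℝ (Fin 2) → Y0 N}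
    {f : (Fin 2 → ℝ) → ℍ} (h : IsSmoothLift N s f) :
    lineIntegral g f = G (f (edge 1)) - G (f (edge 0)) := by
  obtain ⟨V, hV, hsub, hf⟩ := h.path
  unfold lineIntegral
  have hI : Set.uIcc (0 : ℝ) 1 = Set.Icc 0 1 := Set.uIcc_of_le zero_le_one
  refine intervalIntegral.integral_eq_sub_of_hasDerivAt
    (f := fun t : ℝ => G (f (edge t) : ℂ)) (fun t ht => ?_) ?_
  · rw [hI] at ht
    exact (hG _).comp t (h.hasDerivAt ht)
  · refine ContinuousOn.intervalIntegrable ?_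
    rw [hI]
    refine ContinuousOn.mul ?_ ?_
    · have h1 : ContinuousOn (fun t : ℝ => g (ofComplex (f (edge t) : ℂ))) (Set.Icc 0 1) :=
        hg.holo.continuousOn.comp (hf.continuousOn.mono hsub) fun t _ => (f (edge t)).im_pos
      simpa using h1
    · exact (hf.continuousOn_deriv_of_isOpen hV (by simp)).mono hsub

lemma hasDerivAt_moebius (γ : SL(2, ℤ)) (z : ℍ) :
    HasDerivAt (fun w : ℂ => ((γ 0 0 : ℂ) * w + γ 0 1) / ((γ 1 0 : ℂ) * w + γ 1 1))
      (1 / denom γ z ^ 2) z := by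
  have hd : (γ 1 0 : ℂ) * z + γ 1 1 ≠ 0 := by
    simpa [ModularGroup.denom_apply] using denom_ne_zero γ z
  have hdet : (γ 0 0 : ℂ) * γ 1 1 - γ 0 1 * γ 1 0 = 1 := by
    have := Matrix.det_fin_two γ.1
    rw [γ.2] at this
    exact_mod_cast this.symm
  have h1 : HasDerivAt (fun w : ℂ => (γ 0 0 : ℂ) * w + γ 0 1) (γ 0 0 : ℂ) (z : ℂ) := by
    simpa using ((hasDerivAt_id (z : ℂ)).const_mul (γ 0 0 : ℂ)).add_const (γ 0 1 : ℂ)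
  have h2 : HasDerivAt (fun w : ℂ => (γ 1 0 : ℂ) * w + γ 1 1) (γ 1 0 : ℂ) (z : ℂ) := by
    simpa using ((hasDerivAt_id (z : ℂ)).const_mul (γ 1 0 : ℂ)).add_const (γ 1 1 : ℂ)
  refine (h1.div h2 hd).congr_deriv ?_
  rw [ModularGroup.denom_apply]
  congr 1
  linear_combination hdet

lemma InvariantForm.lineIntegral_congr {N : ℕ} {g : ℍ → ℂ} (hg : InvariantForm N g)
    {s : stdSimplex ℝ (Fin 2) → Y0 N} {f₁ f₂ : (Fin 2 → ℝ) → ℍ}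
    (h₁ : IsSmoothLift N s f₁) (h₂ : IsSmoothLift N s f₂) :
    lineIntegral g f₁ = lineIntegral g f₂ := by
  let A : Gamma0 N → Set ℝ := fun γ =>
    {t | t ∈ Set.Icc (0 : ℝ) 1 ∧ f₁ (edge t) = (γ : SL(2, ℤ)) • f₂ (edge t)}
  have hcount : Countable (Gamma0 N) := by
    have h1 : Countable (Matrix (Fin 2) (Fin 2) ℤ) :=
      inferInstanceAs (Countable (Fin 2 → Fin 2 → ℤ))
    have h2 : Countable SL(2, ℤ) := Subtype.countable
    infer_instance
  have hbad : (⋃ γ, {t ∈ A γ | nhdsWithin t (A γ ∩ Set.Ioi t) = ⊥}).Countable :=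
    Set.countable_iUnion fun γ => countable_setOfPred_isolated_right_within
  refine intervalIntegral.integral_congr_ae ?_
  have hnull : ∀ᵐ t : ℝ, t ∉ ⋃ γ, {t ∈ A γ | nhdsWithin t (A γ ∩ Set.Ioi t) = ⊥} :=
    measure_eq_zero_iff_ae_notMem.1 (hbad.measure_zero _)
  filter_upwards [hnull] with t ht htI
  rw [Set.uIoc_of_le zero_le_one] at htI
  have htc : t ∈ Set.Icc (0 : ℝ) 1 := ⟨htI.1.le, htI.2⟩
  obtain ⟨γ, hγ, heq⟩ := proj_eq_iff.1
    ((h₁.2 ⟨_, edge_mem htc⟩).symm.trans (h₂.2 ⟨_, edge_mem htc⟩))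
  change f₁ (edge t) = γ • f₂ (edge t) at heq
  have htA : t ∈ A ⟨γ, hγ⟩ := ⟨htc, heq⟩
  have hacc : (nhdsWithin t (A ⟨γ, hγ⟩ ∩ Set.Ioi t)).NeBot := by
    refine ⟨fun hbot => ht (Set.mem_iUnion.2 ⟨⟨γ, hγ⟩, htA, hbot⟩)⟩
  have hU : UniqueDiffWithinAt ℝ (A ⟨γ, hγ⟩) t := by
    rw [uniqueDiffWithinAt_iff_accPt, accPt_principal_iff_nhdsWithin]
    refine hacc.mono (nhdsWithin_mono t ?_)
    rintro u ⟨hu, hut⟩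
    exact ⟨hu, (Set.mem_Ioi.1 hut).ne'⟩
  have hd₁ := (h₁.hasDerivAt htc).hasDerivWithinAt (s := A ⟨γ, hγ⟩)
  have hd₂ := ((hasDerivAt_moebius γ (f₂ (edge t))).comp t
    (h₂.hasDerivAt htc)).hasDerivWithinAt (s := A ⟨γ, hγ⟩)
  have hcoe : ∀ u ∈ A ⟨γ, hγ⟩, (f₁ (edge u) : ℂ) =
      ((γ 0 0 : ℂ) * (f₂ (edge u) : ℂ) + γ 0 1) / ((γ 1 0 : ℂ) * (f₂ (edge u) : ℂ) + γ 1 1) := by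
    intro u hu
    rw [hu.2, specialLinearGroup_apply]
    simp
  have hder := hU.eq_deriv _ hd₁ (hd₂.congr hcoe (hcoe t htA))
  rw [hder, heq, hg.inv γ hγ]
  have hne := denom_ne_zero γ (f₂ (edge t))
  field_simp

/-- The integral of an invariant form along a simplex does not depend on the lift. -/
lemma InvariantForm.simplexIntegral_eq {N : ℕ} {g : ℍ → ℂ} (hg : InvariantForm N g)
    (s : SmoothSimplex N 1) {f : (Fin 2 → ℝ) → ℍ} (h : IsSmoothLift N s.1 f) :
    simplexIntegral N g s = lineIntegral g f :=
  hg.lineIntegral_congr s.2.choose_spec h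

lemma map_edge_zero (i : Fin 3) :
    FunOnFinite.linearMap ℝ ℝ i.succAbove (edge 0) = Pi.single (i.succAbove 0) 1 := by
  have h : edge 0 = Pi.single 0 1 := by ext j; fin_cases j <;> simp [edge]
  rw [h]; simp

lemma map_edge_one (i : Fin 3) :
    FunOnFinite.linearMap ℝ ℝ i.succAbove (edge 1) = Pi.single (i.succAbove 1) 1 := by
  have h : edge 1 = Pi.single 1 1 := by ext j; fin_cases j <;> simp [edge]
  rw [h]; simp

/-- Integration over `1`-chains. -/
def chainIntegral (N : ℕ) (g : ℍ → ℂ) : Chain N 1 →ₗ[ℤ] ℂ :=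
  Finsupp.linearCombination ℤ (simplexIntegral N g)

lemma InvariantForm.chainIntegral_boundary {N : ℕ} {g : ℍ → ℂ} (hg : InvariantForm N g)
    (x : Chain N 2) : chainIntegral N g (boundary N 1 x) = 0 := by
  suffices h : (chainIntegral N g).comp (boundary N 1) = 0 from LinearMap.congr_fun h x
  refine Finsupp.lhom_ext' fun s => LinearMap.ext_ring ?_
  obtain ⟨f, hf⟩ := s.2
  obtain ⟨G, hG⟩ := hg.exists_primitive
  have key : ∀ i : Fin 3, simplexIntegral N g (face s i) =
      G (f (Pi.single (i.succAbove 1) 1)) - G (f (Pi.single (i.succAbove 0) 1)) := by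
    intro i
    have hl := isSmoothLift_face hf i
    rw [hg.simplexIntegral_eq (face s i) hl, hg.lineIntegral_eq hG hl, map_edge_zero,
      map_edge_one]
  have e0 : (0 : Fin 3).succAbove (1 : Fin 2) = 2 := rfl
  have e1 : (0 : Fin 3).succAbove (0 : Fin 2) = 1 := rfl
  have e2 : (1 : Fin 3).succAbove (1 : Fin 2) = 2 := rfl
  have e3 : (1 : Fin 3).succAbove (0 : Fin 2) = 0 := rfl
  have e4 : (2 : Fin 3).succAbove (1 : Fin 2) = 1 := rfl
  have e5 : (2 : Fin 3).succAbove (0 : Fin 2) = 0 := rfl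
  simp only [boundary, chainIntegral, LinearMap.comp_apply, Finsupp.lsingle_apply,
    Finsupp.linearCombination_single, map_sum, map_smul, one_smul, LinearMap.zero_apply, key]
  refine (Fin.sum_univ_three _).trans ?_
  rw [e0, e1, e2, e3, e4, e5]
  simp

/-- The cohomology class of the `1`-form on `Y₀(N)` induced by `g(z) dz`: integration against
cycles. -/
def formClass {N : ℕ} {g : ℍ → ℂ} (hg : InvariantForm N g) : H1dual N :=
  Submodule.liftQ _ ((chainIntegral N g).comp (Cycles N).subtype) (by
    rintro ⟨x, hx⟩ ⟨y, hy⟩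
    change chainIntegral N g x = 0
    change boundary N 1 y = x at hy
    rw [← hy]
    exact hg.chainIntegral_boundary y)

/-! ## The Eisenstein class -/

/-- The point `N z`. -/
def mulPoint (N : ℕ) [NeZero N] (z : ℍ) : ℍ :=
  ⟨N * z, by
    have : (0 : ℝ) < N := Nat.cast_pos.2 (NeZero.pos N)
    simpa using mul_pos this z.im_pos⟩

/-- The modified Eisenstein series of weight `2`,
`E₂*(z) = 1 - 3 / (π y) - 24 ∑ σ₁(n) e(nz)`. -/
def E2Star (z : ℍ) : ℂ := EisensteinSeries.E2 z - 3 / (Real.pi * z.im)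

/-- The Eisenstein series of weight `2` and level `N`,
`E_{2,N}(z) = (N E₂*(Nz) - E₂*(z)) / (N - 1)`. -/
def E2N (N : ℕ) [NeZero N] (z : ℍ) : ℂ :=
  (N * E2Star (mulPoint N z) - E2Star z) / (N - 1)

lemma E2N_eq (N : ℕ) [NeZero N] (z : ℍ) : E2N N z =
    (N * EisensteinSeries.E2 (mulPoint N z) - EisensteinSeries.E2 z) / (N - 1) := by
  have hN : (N : ℂ) ≠ 0 := Nat.cast_ne_zero.2 (NeZero.ne N)
  have hz : (z.im : ℂ) ≠ 0 := Complex.ofReal_ne_zero.2 z.im_ne_zero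
  have hpi : (Real.pi : ℂ) ≠ 0 := Complex.ofReal_ne_zero.2 Real.pi_ne_zero
  have him : ((mulPoint N z).im : ℂ) = N * z.im := by
    have : (mulPoint N z).im = N * z.im := by
      change ((N : ℂ) * z).im = _
      simp
    rw [this]; push_cast; ring
  unfold E2N E2Star
  rw [him]
  congr 1
  field_simp
  ring

lemma E2_smul (γ : SL(2, ℤ)) (z : ℍ) : EisensteinSeries.E2 (γ • z) =
    denom γ z ^ 2 * EisensteinSeries.E2 z -
      1 / (2 * riemannZeta 2) * (2 * Real.pi * Complex.I * γ 1 0) * denom γ z := by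
  have h := congrFun (EisensteinSeries.E2_slash_action γ) z
  have hne := denom_ne_zero γ z
  rw [ModularForm.SL_slash_apply] at h
  simp only [Pi.sub_apply, Pi.smul_apply, EisensteinSeries.D2, smul_eq_mul] at h
  rw [zpow_neg, zpow_ofNat] at h
  field_simp at h ⊢
  linear_combination h

lemma E2_differentiableOn :
    DifferentiableOn ℂ (fun z : ℂ => EisensteinSeries.E2 (ofComplex z)) {z : ℂ | 0 < z.im} :=
  UpperHalfPlane.mdifferentiable_iff.1 E2_mdifferentiable

lemma exists_conj {N : ℕ} [NeZero N] {γ : SL(2, ℤ)} (hγ : γ ∈ Gamma0 N) :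
    ∃ δ : SL(2, ℤ), γ 1 0 = N * δ 1 0 ∧
      ∀ z, denom δ (mulPoint N z) = denom γ z ∧ mulPoint N (γ • z) = δ • mulPoint N z := by
  rw [Gamma0_mem, ZMod.intCast_zmod_eq_zero_iff_dvd] at hγ
  obtain ⟨c, hc⟩ := hγ
  have hdet : γ 0 0 * γ 1 1 - γ 0 1 * γ 1 0 = 1 := by
    have := Matrix.det_fin_two γ.1
    rw [γ.2] at this
    exact this.symm
  obtain ⟨δ, h00, h01, h10, h11⟩ : ∃ δ : SL(2, ℤ),
      δ 0 0 = γ 0 0 ∧ δ 0 1 = N * γ 0 1 ∧ δ 1 0 = c ∧ δ 1 1 = γ 1 1 := by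
    refine ⟨⟨!![γ 0 0, N * γ 0 1; c, γ 1 1], ?_⟩, rfl, rfl, rfl, rfl⟩
    rw [Matrix.det_fin_two_of]
    linear_combination hdet + γ 0 1 * hc
  refine ⟨δ, by rw [h10]; exact hc, fun z => ?_⟩
  have hc' : (γ 1 0 : ℂ) = N * c := by exact_mod_cast hc
  have hd := denom_ne_zero γ z
  have hcoe : (mulPoint N z : ℂ) = N * z := rfl
  constructor
  · rw [ModularGroup.denom_apply, ModularGroup.denom_apply, hcoe, hc', h10, h11]
    ring
  · refine UpperHalfPlane.ext ?_
    have h1 : (mulPoint N (γ • z) : ℂ) = N * ((γ • z : ℍ) : ℂ) := rfl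
    rw [ModularGroup.denom_apply, hc'] at hd
    have hd' : (c : ℂ) * (N * z) + γ 1 1 ≠ 0 := by
      intro h0
      apply hd
      linear_combination h0
    rw [h1, coe_specialLinearGroup_apply, coe_specialLinearGroup_apply, hcoe, h00, h01, h10, h11]
    simp only [algebraMap_int_eq, eq_intCast, Complex.ofReal_intCast, hc', Int.cast_mul,
      Int.cast_natCast]
    rw [← mul_div_assoc, div_eq_div_iff hd hd']
    push_cast
    ring

lemma invariantForm_E2N (N : ℕ) [NeZero N] : InvariantForm N (E2N N) := by
  refine ⟨?_, ?_⟩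
  · have hmaps : Set.MapsTo (fun z : ℂ => (N : ℂ) * z) {z : ℂ | 0 < z.im} {z : ℂ | 0 < z.im} := by
      intro z hz
      have : (0 : ℝ) < N := Nat.cast_pos.2 (NeZero.pos N)
      simpa using mul_pos this hz
    have h1 : DifferentiableOn ℂ (fun z : ℂ => EisensteinSeries.E2 (ofComplex (N * z)))
        {z : ℂ | 0 < z.im} :=
      E2_differentiableOn.comp (differentiableOn_id.const_mul (N : ℂ)) hmaps
    refine (((h1.const_mul (N : ℂ)).sub E2_differentiableOn).div_const ((N : ℂ) - 1)).congr
      fun z hz => ?_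
    have h2 : mulPoint N (ofComplex z) = ofComplex (N * z) := by
      refine UpperHalfPlane.ext ?_
      rw [ofComplex_apply_of_im_pos (hmaps hz), ofComplex_apply_of_im_pos hz]
      rfl
    simp only [E2N_eq, h2, Pi.sub_apply]
  · intro γ hγ z
    obtain ⟨δ, hδ, h⟩ := exists_conj hγ
    obtain ⟨h1, h2⟩ := h z
    have hc : (γ 1 0 : ℂ) = N * δ 1 0 := by exact_mod_cast hδ
    rw [E2N_eq, E2N_eq, h2, E2_smul, E2_smul, h1, hc]
    ring

/-- The Eisenstein class `ω_E(N)`: the class of `E_{2,N}(z) dz`. -/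
def eisensteinClass (N : ℕ) [NeZero N] : H1dual N := formClass (invariantForm_E2N N)

/-! ## Closed geodesics and their homology classes -/

/-- The matrix `γ` is hyperbolic. -/
def IsHyperbolic (γ : SL(2, ℤ)) : Prop := 2 < |(γ : Matrix (Fin 2) (Fin 2) ℤ).trace|

/-- The trace of `± γ ∈ PSL₂(ℤ)`, where the sign is normalized by taking the representative whose
lower left entry is positive. -/
def normTrace (γ : SL(2, ℤ)) : ℤ := (γ 1 0).sign * (γ : Matrix (Fin 2) (Fin 2) ℤ).trace

/-- The length `2 log λ` of the closed geodesic of `γ`, where `λ + λ⁻¹ = |tr γ|`, `λ > 1`. -/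
def geodesicLength (γ : SL(2, ℤ)) : ℝ :=
  2 * Real.log ((|(γ 0 0 + γ 1 1 : ℝ)| + √((γ 0 0 + γ 1 1 : ℝ) ^ 2 - 4)) / 2)

/-- The radius `r` of the semicircle `S_γ` fixed by `γ`. -/
def radius (γ : SL(2, ℤ)) : ℝ :=
  √(((γ 0 0 + γ 1 1 : ℝ) / (2 * γ 1 0)) ^ 2 - ((γ 1 0 : ℝ) ^ 2)⁻¹)

/-- The sign `ε` of `c (a + d)`. -/
def orientation (γ : SL(2, ℤ)) : ℝ :=
  (γ 1 0 * (γ 0 0 + γ 1 1) : ℝ) / |(γ 1 0 * (γ 0 0 + γ 1 1) : ℝ)|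

/-- The point at signed distance `t` from the top of the semicircle `S_γ`, which is oriented towards
the attracting fixed point `(a - d) / (2 c) + ε r` of `γ`. This is `g_γ a_t i` with
`a_t = diag(e^{t/2}, e^{-t/2})` and
`g_γ = (2r)^{-1/2} ((a - d) / (2c) + ε r, ε (a - d) / (2c) - r; 1, ε)`. -/
def geodesicPoint (γ : SL(2, ℤ)) (t : ℝ) : ℂ :=
  (((γ 0 0 - γ 1 1 : ℝ) / (2 * γ 1 0) + orientation γ * radius γ * Real.tanh t : ℝ) : ℂ) +
    ((radius γ / Real.cosh t : ℝ) : ℂ) * Complex.I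

/-- The segment `g_γ a_t i`, `-ℓ/2 ≤ t ≤ ℓ/2`, of `S_γ`, where `ℓ` is the length of the closed
geodesic, as a map on the `1`-simplex. It goes from some `w ∈ S_γ` to `γ w`. -/
def geodesicLift (γ : SL(2, ℤ)) (x : Fin 2 → ℝ) : ℍ :=
  ofComplex (geodesicPoint γ (geodesicLength γ * (x 1 - 1 / 2)))

lemma IsHyperbolic.ne_zero {γ : SL(2, ℤ)} (h : IsHyperbolic γ) : γ 1 0 ≠ 0 := by
  intro hc
  have hdet : γ 0 0 * γ 1 1 - γ 0 1 * γ 1 0 = 1 := by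
    have := Matrix.det_fin_two γ.1
    rw [γ.2] at this
    exact this.symm
  rw [hc, mul_zero, sub_zero] at hdet
  unfold IsHyperbolic at h
  rw [Matrix.trace_fin_two] at h
  rcases Int.eq_one_or_neg_one_of_mul_eq_one' hdet with ⟨h1, h2⟩ | ⟨h1, h2⟩ <;>
    simp [h1, h2] at h

lemma IsHyperbolic.four_lt {γ : SL(2, ℤ)} (h : IsHyperbolic γ) :
    4 < (γ 0 0 + γ 1 1 : ℝ) ^ 2 := by
  unfold IsHyperbolic at h
  rw [Matrix.trace_fin_two] at h
  have h' : (2 : ℝ) < |(γ 0 0 + γ 1 1 : ℝ)| := by exact_mod_cast h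
  rw [← sq_abs]
  nlinarith

lemma IsHyperbolic.radius_pos {γ : SL(2, ℤ)} (h : IsHyperbolic γ) : 0 < radius γ := by
  refine Real.sqrt_pos.2 ?_
  have hc : (γ 1 0 : ℝ) ≠ 0 := Int.cast_ne_zero.2 h.ne_zero
  have h4 := h.four_lt
  have hc2 : 0 < (γ 1 0 : ℝ) ^ 2 := by positivity
  have : ((γ 0 0 + γ 1 1 : ℝ) / (2 * γ 1 0)) ^ 2 - ((γ 1 0 : ℝ) ^ 2)⁻¹ =
      ((γ 0 0 + γ 1 1 : ℝ) ^ 2 - 4) / (4 * (γ 1 0 : ℝ) ^ 2) := by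
    field_simp
    ring
  rw [this]
  exact div_pos (by linarith) (by positivity)

lemma IsHyperbolic.im_pos {γ : SL(2, ℤ)} (h : IsHyperbolic γ) (t : ℝ) :
    0 < (geodesicPoint γ t).im := by
  have := div_pos h.radius_pos (Real.cosh_pos t)
  have him : (geodesicPoint γ t).im = radius γ / Real.cosh t := by
    simp only [geodesicPoint, Complex.add_im, Complex.ofReal_im, Complex.mul_im, Complex.ofReal_re,
      Complex.I_re, Complex.I_im]
    ring
  rw [him]
  exact this

lemma IsHyperbolic.coe_geodesicLift {γ : SL(2, ℤ)} (h : IsHyperbolic γ) (x : Fin 2 → ℝ) :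
    (geodesicLift γ x : ℂ) = geodesicPoint γ (geodesicLength γ * (x 1 - 1 / 2)) := by
  rw [geodesicLift, ofComplex_apply_of_im_pos (h.im_pos _)]

lemma contDiff_geodesicPoint (γ : SL(2, ℤ)) : ContDiff ℝ ∞ (geodesicPoint γ) := by
  have hcosh : ContDiff ℝ ∞ Real.cosh := Real.contDiff_cosh
  have htanh : ContDiff ℝ ∞ Real.tanh := by
    have : Real.tanh = fun t => Real.sinh t / Real.cosh t := funext Real.tanh_eq_sinh_div_cosh
    rw [this]
    exact Real.contDiff_sinh.div hcosh fun t => (Real.cosh_pos t).ne'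
  unfold geodesicPoint
  refine ContDiff.add (Complex.ofRealCLM.contDiff.comp ?_)
    (ContDiff.mul (Complex.ofRealCLM.contDiff.comp ?_) contDiff_const)
  · exact contDiff_const.add (contDiff_const.mul htanh)
  · exact contDiff_const.div hcosh fun t => (Real.cosh_pos t).ne'

lemma IsHyperbolic.isSmoothLift {γ : SL(2, ℤ)} (N : ℕ) (h : IsHyperbolic γ) :
    IsSmoothLift N (fun x : stdSimplex ℝ (Fin 2) => proj N (geodesicLift γ x))
      (geodesicLift γ) := by
  refine ⟨⟨Set.univ, isOpen_univ, Set.subset_univ _, ContDiff.contDiffOn ?_⟩, fun x => rfl⟩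
  simp only [h.coe_geodesicLift]
  exact (contDiff_geodesicPoint γ).comp
    (contDiff_const.mul ((contDiff_apply ℝ ℝ 1).sub contDiff_const))

/-- The closed geodesic of a hyperbolic `γ`, as a smooth `1`-simplex of `Y₀(N)`. -/
def geodesicSimplex (N : ℕ) (γ : SL(2, ℤ)) (h : IsHyperbolic γ) : SmoothSimplex N 1 :=
  ⟨fun x => proj N (geodesicLift γ x), _, h.isSmoothLift N⟩

lemma IsHyperbolic.cosh_length {γ : SL(2, ℤ)} (h : IsHyperbolic γ) :
    Real.cosh (geodesicLength γ / 2) = |(γ 0 0 + γ 1 1 : ℝ)| / 2 ∧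
    Real.sinh (geodesicLength γ / 2) = √((γ 0 0 + γ 1 1 : ℝ) ^ 2 - 4) / 2 := by
  have h4 := h.four_lt
  unfold geodesicLength
  rw [mul_div_cancel_left₀ _ (two_ne_zero), ← sq_abs (γ 0 0 + γ 1 1 : ℝ)]
  rw [← sq_abs] at h4
  set T := |(γ 0 0 + γ 1 1 : ℝ)|
  have hT : 0 ≤ T := abs_nonneg _
  have hTpos : 0 < T := by nlinarith
  have hR : √(T ^ 2 - 4) ^ 2 = T ^ 2 - 4 := Real.sq_sqrt (by linarith)
  have hR0 : 0 ≤ √(T ^ 2 - 4) := Real.sqrt_nonneg _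
  set R := √(T ^ 2 - 4)
  have hl : 0 < (T + R) / 2 := by positivity
  have hinv : ((T + R) / 2)⁻¹ = (T - R) / 2 := by
    refine inv_eq_of_mul_eq_one_right ?_
    linear_combination (-1 / 4) * hR
  rw [Real.cosh_log hl, Real.sinh_log hl, hinv]
  constructor <;> ring

lemma IsHyperbolic.radius_eq {γ : SL(2, ℤ)} (h : IsHyperbolic γ) :
    radius γ = √((γ 0 0 + γ 1 1 : ℝ) ^ 2 - 4) / (2 * |(γ 1 0 : ℝ)|) := by
  have hc : (γ 1 0 : ℝ) ≠ 0 := Int.cast_ne_zero.2 h.ne_zero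
  have h4 := h.four_lt
  have : ((γ 0 0 + γ 1 1 : ℝ) / (2 * γ 1 0)) ^ 2 - ((γ 1 0 : ℝ) ^ 2)⁻¹ =
      ((γ 0 0 + γ 1 1 : ℝ) ^ 2 - 4) / (2 * |(γ 1 0 : ℝ)|) ^ 2 := by
    rw [mul_pow, sq_abs]
    field_simp
    ring
  rw [radius, this, Real.sqrt_div (by linarith), Real.sqrt_sq (by positivity)]

lemma IsHyperbolic.height_sq {γ : SL(2, ℤ)} (h : IsHyperbolic γ) :
    (((radius γ / Real.cosh (geodesicLength γ / 2) : ℝ) : ℂ)) ^ 2 =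
      ((γ 0 0 + γ 1 1 : ℂ) ^ 2 - 4) / ((γ 1 0 : ℂ) ^ 2 * (γ 0 0 + γ 1 1 : ℂ) ^ 2) := by
  have h4 := h.four_lt
  have key : (radius γ / Real.cosh (geodesicLength γ / 2)) ^ 2 =
      ((γ 0 0 + γ 1 1 : ℝ) ^ 2 - 4) / ((γ 1 0 : ℝ) ^ 2 * (γ 0 0 + γ 1 1 : ℝ) ^ 2) := by
    rw [h.radius_eq, h.cosh_length.1, div_pow, div_pow, Real.sq_sqrt (by linarith), mul_pow,
      div_pow, sq_abs, sq_abs]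
    field_simp
  exact_mod_cast congrArg (fun x : ℝ => (x : ℂ)) key

lemma IsHyperbolic.geodesicPoint_ends {γ : SL(2, ℤ)} (h : IsHyperbolic γ) :
    geodesicPoint γ (geodesicLength γ / 2) = (γ 0 0 : ℂ) / γ 1 0 -
        2 / (γ 1 0 * (γ 0 0 + γ 1 1)) +
        ((radius γ / Real.cosh (geodesicLength γ / 2) : ℝ) : ℂ) * Complex.I ∧
    geodesicPoint γ (-(geodesicLength γ / 2)) = -(γ 1 1 : ℂ) / γ 1 0 +
        2 / (γ 1 0 * (γ 0 0 + γ 1 1)) +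
        ((radius γ / Real.cosh (geodesicLength γ / 2) : ℝ) : ℂ) * Complex.I := by
  have h4 := h.four_lt
  have hc : (γ 1 0 : ℝ) ≠ 0 := Int.cast_ne_zero.2 h.ne_zero
  have hs : (γ 0 0 + γ 1 1 : ℝ) ≠ 0 := by
    intro h0
    rw [h0] at h4
    norm_num at h4
  have hx : orientation γ * radius γ * Real.tanh (geodesicLength γ / 2) =
      ((γ 0 0 + γ 1 1 : ℝ) ^ 2 - 4) / (2 * γ 1 0 * (γ 0 0 + γ 1 1)) := by
    rw [Real.tanh_eq_sinh_div_cosh, h.cosh_length.1, h.cosh_length.2, h.radius_eq, orientation,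
      abs_mul]
    have hR : √((γ 0 0 + γ 1 1 : ℝ) ^ 2 - 4) ^ 2 = (γ 0 0 + γ 1 1 : ℝ) ^ 2 - 4 :=
      Real.sq_sqrt (by linarith)
    have h1 := sq_abs (γ 0 0 + γ 1 1 : ℝ)
    have h2 := sq_abs (γ 1 0 : ℝ)
    have h3 : |(γ 0 0 + γ 1 1 : ℝ)| ≠ 0 := abs_ne_zero.2 hs
    have h5 : |(γ 1 0 : ℝ)| ≠ 0 := abs_ne_zero.2 hc
    field_simp
    rw [hR, h1, h2]
  have e1 : (γ 0 0 - γ 1 1 : ℝ) / (2 * γ 1 0) +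
      ((γ 0 0 + γ 1 1 : ℝ) ^ 2 - 4) / (2 * γ 1 0 * (γ 0 0 + γ 1 1)) =
      γ 0 0 / γ 1 0 - 2 / (γ 1 0 * (γ 0 0 + γ 1 1)) := by
    field_simp
    ring
  have e2 : (γ 0 0 - γ 1 1 : ℝ) / (2 * γ 1 0) -
      ((γ 0 0 + γ 1 1 : ℝ) ^ 2 - 4) / (2 * γ 1 0 * (γ 0 0 + γ 1 1)) =
      -γ 1 1 / γ 1 0 + 2 / (γ 1 0 * (γ 0 0 + γ 1 1)) := by
    field_simp
    ring
  constructor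
  · rw [geodesicPoint, hx, e1]
    push_cast
    ring
  · rw [geodesicPoint, Real.tanh_neg, Real.cosh_neg, mul_neg, hx, ← sub_eq_add_neg, e2]
    push_cast
    ring

/-- The end point of the geodesic segment is the image of its starting point under `γ`. -/
lemma IsHyperbolic.smul_geodesicLift {γ : SL(2, ℤ)} (h : IsHyperbolic γ) :
    geodesicLift γ (Pi.single 1 1) = γ • geodesicLift γ (Pi.single 0 1) := by
  obtain ⟨hp, hm⟩ := h.geodesicPoint_ends
  have hc : (γ 1 0 : ℂ) ≠ 0 := Int.cast_ne_zero.2 h.ne_zero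
  have h4 := h.four_lt
  have hs : (γ 0 0 + γ 1 1 : ℂ) ≠ 0 := by
    intro h0
    have h0' : (γ 0 0 + γ 1 1 : ℝ) = 0 := by exact_mod_cast h0
    rw [h0'] at h4
    norm_num at h4
  have hdet : (γ 0 0 : ℂ) * γ 1 1 - γ 0 1 * γ 1 0 = 1 := by
    have := Matrix.det_fin_two γ.1
    rw [γ.2] at this
    exact_mod_cast this.symm
  have hz1 : (geodesicLift γ (Pi.single 1 1) : ℂ) = geodesicPoint γ (geodesicLength γ / 2) := by
    rw [h.coe_geodesicLift]
    congr 1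
    simp
    ring
  have hz0 : (geodesicLift γ (Pi.single 0 1) : ℂ) = geodesicPoint γ (-(geodesicLength γ / 2)) := by
    rw [h.coe_geodesicLift]
    congr 1
    simp
    ring
  have hd := denom_ne_zero γ (geodesicLift γ (Pi.single 0 1))
  rw [ModularGroup.denom_apply] at hd
  refine UpperHalfPlane.ext ?_
  rw [coe_specialLinearGroup_apply]
  simp only [algebraMap_int_eq, eq_intCast, Complex.ofReal_intCast]
  rw [eq_div_iff hd, hz1, hz0, hp, hm]
  set a : ℂ := (γ 0 0 : ℂ)
  set b : ℂ := (γ 0 1 : ℂ)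
  set c : ℂ := (γ 1 0 : ℂ)
  set d : ℂ := (γ 1 1 : ℂ)
  set k : ℂ := (((radius γ / Real.cosh (geodesicLength γ / 2)) : ℝ) : ℂ) with hkdef
  have hh : k ^ 2 = ((a + d) ^ 2 - 4) / (c ^ 2 * (a + d) ^ 2) := h.height_sq
  have hI := Complex.I_sq
  obtain ⟨u, hu⟩ : ∃ u : ℂ, c * u = 1 := ⟨c⁻¹, mul_inv_cancel₀ hc⟩
  obtain ⟨v, hv⟩ : ∃ v : ℂ, (a + d) * v = 1 := ⟨(a + d)⁻¹, mul_inv_cancel₀ hs⟩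
  have hk : k ^ 2 = u ^ 2 - 4 * u ^ 2 * v ^ 2 := by
    rw [hh, eq_inv_of_mul_eq_one_right hu, eq_inv_of_mul_eq_one_right hv]
    field_simp
  have hz : c * (-d / c + 2 / (c * (a + d)) + k * Complex.I) + d = 2 * v + c * k * Complex.I := by
    rw [eq_inv_of_mul_eq_one_right hv]
    field_simp
    ring
  have q1 : a / c - 2 / (c * (a + d)) + k * Complex.I = a * u - 2 * u * v + k * Complex.I := by
    rw [eq_inv_of_mul_eq_one_right hu, eq_inv_of_mul_eq_one_right hv]
    field_simp
  have q2 : -d / c + 2 / (c * (a + d)) + k * Complex.I = -d * u + 2 * u * v + k * Complex.I := by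
    rw [eq_inv_of_mul_eq_one_right hu, eq_inv_of_mul_eq_one_right hv]
    field_simp
  rw [hz, q1, q2]
  linear_combination (a * k * Complex.I - 2 * v * k * Complex.I - u + 4 * u * v ^ 2 + b) * hu +
    u * hdet + c * k ^ 2 * hI - c * hk

lemma geodesicSimplex_mem (N : ℕ) {γ : SL(2, ℤ)} (hγ : γ ∈ Gamma0 N) (h : IsHyperbolic γ) :
    Finsupp.single (geodesicSimplex N γ h) 1 ∈ Cycles N := by
  have hf : face (geodesicSimplex N γ h) 0 = face (geodesicSimplex N γ h) 1 := by
    refine Subtype.ext (funext fun x => ?_)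
    obtain rfl : x = stdSimplex.vertex 0 := Subsingleton.elim _ _
    have e0 : (0 : Fin 2).succAbove (0 : Fin 1) = 1 := rfl
    have e1 : (1 : Fin 2).succAbove (0 : Fin 1) = 0 := rfl
    simp only [face, geodesicSimplex, stdSimplex.map_vertex, e0, e1]
    exact proj_eq_iff.2 ⟨γ, hγ, h.smul_geodesicLift⟩
  rw [LinearMap.mem_ker]
  simp only [boundary, Finsupp.linearCombination_single, one_smul]
  refine (Fin.sum_univ_two _).trans ?_
  rw [hf]
  simp

/-- The homology class `[𝒞] ∈ H₁(Y₀(N), ℤ)` of the oriented closed geodesic `𝒞` on `Y₀(N)` that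
corresponds to the conjugacy class of the hyperbolic `γ ∈ Γ₀(N)`. -/
def geodesicClass (N : ℕ) (γ : SL(2, ℤ)) (hγ : γ ∈ Gamma0 N) (h : IsHyperbolic γ) : H1 N :=
  Submodule.Quotient.mk ⟨Finsupp.single (geodesicSimplex N γ h) 1, geodesicSimplex_mem N hγ h⟩

lemma Gamma0_le_of_dvd {N q : ℕ} (h : N ∣ q) : Gamma0 q ≤ Gamma0 N := by
  intro γ hγ
  rw [Gamma0_mem, ZMod.intCast_zmod_eq_zero_iff_dvd] at hγ ⊢
  exact (Int.natCast_dvd_natCast.2 h).trans hγ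

/-- A double coset embedding of level `q`: a map `ψ : (ℤ/qℤ)ˣ → Γ₀(q)` such that
`ψ(a) ∞ ≡ a / q mod 1` and `|tr ψ(a)| > 2`. An element of `Γ₀(q) ≤ PSL₂(ℤ)` is given by one of the
two matrices that represent it; which one does not matter for anything below. -/
structure DoubleCosetEmbedding (q : ℕ) where
  /-- The underlying map. -/
  toFun : (ZMod q)ˣ → SL(2, ℤ)
  mem_Gamma0 : ∀ a, toFun a ∈ Gamma0 q
  smul_infty : ∀ a, ∃ n : ℤ,
    Matrix.SpecialLinearGroup.mapGL ℚ (toFun a) • (OnePoint.infty : OnePoint ℚ) =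
      (((a : ZMod q).val / q + n : ℚ) : OnePoint ℚ)
  hyperbolic : ∀ a, IsHyperbolic (toFun a)

/-- The homology class `[𝒞_a^ψ(N)] ∈ H₁(Y₀(N), ℤ)`, for `N ∣ q`. -/
def DoubleCosetEmbedding.homologyClass {q : ℕ} (ψ : DoubleCosetEmbedding q) {N : ℕ} (h : N ∣ q)
    (a : (ZMod q)ˣ) : H1 N :=
  geodesicClass N (ψ.toFun a) (Gamma0_le_of_dvd h (ψ.mem_Gamma0 a)) (ψ.hyperbolic a)

/-! ## Local weights -/

open ArithmeticFunction in
/-- The local weight `ν_s(f, χ, n; ℓ)` of a form `f` with Hecke eigenvalues `lam` and nebentypus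
`η`. -/
def localWeight {M m : ℕ} (s : ℂ) (lam : ℕ → ℂ) (η : DirichletCharacter ℂ M)
    (χ : DirichletCharacter ℂ m) (n ℓ : ℕ) : ℂ :=
  ∑ d ∈ (Nat.finMulAntidiag 3 n).filter (fun d => (d 1 * d 2).gcd ℓ ∣ d 2),
    (moebius (d 0) : ℂ) * conj (χ (d 0 : ZMod m)) *
    (d 1 : ℂ) ^ (1 - 2 * s) * η (d 1 : ZMod M) * moebius (d 1) * χ (d 1 : ZMod m) *
    (d 2 : ℂ) ^ (1 - s) * lam (d 2 / (d 2).gcd ℓ) * ((d 2).gcd ℓ : ℂ) ^ s *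
    χ ((ℓ / (d 2).gcd ℓ : ℕ) : ZMod m)

/-- The Hecke eigenvalue `σ₁(n) / √n` of the level `1` Eisenstein series `E = (π y / 6) E₂*`. -/
def eisensteinEigenvalue (n : ℕ) : ℂ := ArithmeticFunction.sigma 1 n / (n : ℂ) ^ (1 / 2 : ℂ)

/-- The local weight `ν(χ, n) = ν_{1/2}(E, χ, n; 1)` of the level `1` Eisenstein series. -/
def eisensteinWeight {m : ℕ} (χ : DirichletCharacter ℂ m) (n : ℕ) : ℂ :=
  localWeight (1 / 2) eisensteinEigenvalue (1 : DirichletCharacter ℂ 1) χ n 1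

instance neZero_conductor {q : ℕ} [NeZero q] (χ : DirichletCharacter ℂ q) : NeZero χ.conductor :=
  ⟨χ.conductor_ne_zero⟩

end EisHom
end

noncomputable section

namespace EisHom

/-! ## The sawtooth function and Dedekind sums -/

/-! The pairing is an integral of an exact form on `ℍ`. If `G` is a primitive of `E₂` (in effect `12
/ (π i) log η`), then `(G(N z) - G(z)) / (N - 1)` is a primitive of `E_{2,N}`, so the period along
the geodesic of `γ = ψ(a)` is the difference of its values at `γ w` and `w`. Dedekind's
transformation formula (`IsLogEta.moebius`) evaluates it. The matrix `γ`, acting on `z`, and its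
conjugate by `diag(N, 1)`, acting on `N z`, have the same automorphy factor, so the logarithms
cancel. What is left (`capPairing_homologyClass`) is `tr ψ(a) / q + 12 / (N - 1) · (s(a, q) - s(a, q
/ N))` with Dedekind sums `s`. The transformation formula is deduced from the cases `z ↦ z + 1` and
`z ↦ -1/z` by Euclid's algorithm, and Dedekind reciprocity is exactly what the inductive step needs.

It remains to sum Dedekind sums against `conj χ`. For even `χ` the sum vanishes, because `s` is odd
in `a`. In general, sort the terms of `s(a, m)` by the exact denominator `d ∣ m` of `r / m`. Each
piece is an autocorrelation of the sawtooth on `(ℤ/dℤ)ˣ`, so its `χ`-component is `φ(q) / φ(d)`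
times the square of the absolute value of `∑ χ*(u) ((u/d))`, and is zero unless the conductor
divides `d` (`sum_conj_mul_primitiveDedekindSum`). Möbius inversion and the distribution relation
turn this sum into an Euler factor times the same sum modulo the conductor (`sawSum_eq`). For odd
`χ` that sum is a Bernoulli number, whose size is given by `L(1, χ*)` (`norm_sum_mul_saw_sq`).

Passing from `q` to `q / N` leaves only the divisors of `q` that do not divide `q / N`. Their Euler
factors all contain `χ*(N) - 1`, up to a degenerate case in which its absolute value is `1`, and the
remaining divisor sum is multiplicative and agrees with `ν` at prime powers (`totientSum_eq`).
Nonnegativity is visible on the Dedekind side, where every term is an absolute square with a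
positive weight. -/

/-- The sawtooth function `((x))`. -/
def saw (x : ℝ) : ℝ := if Int.fract x = 0 then 0 else Int.fract x - 1 / 2

lemma saw_add_intCast (x : ℝ) (n : ℤ) : saw (x + n) = saw x := by
  simp [saw]

lemma saw_zero : saw 0 = 0 := by simp [saw]

lemma saw_eq {x : ℝ} (h0 : 0 < x) (h1 : x < 1) : saw x = x - 1 / 2 := by
  have : Int.fract x = x := Int.fract_eq_self.2 ⟨h0.le, h1⟩
  rw [saw, this, if_neg h0.ne']

lemma saw_neg (x : ℝ) : saw (-x) = -saw x := by
  by_cases h : Int.fract x = 0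
  · have h' : Int.fract (-x) = 0 := Int.fract_neg_eq_zero.2 h
    simp [saw, h, h']
  · have h' : Int.fract (-x) ≠ 0 := fun h' => h (Int.fract_neg_eq_zero.1 h')
    rw [saw, saw, if_neg h, if_neg h', Int.fract_neg h]
    ring

lemma saw_intCast_div_congr {k : ℕ} {a b : ℤ} (h : a ≡ b [ZMOD k]) :
    saw ((a : ℝ) / k) = saw ((b : ℝ) / k) := by
  rcases Nat.eq_zero_or_pos k with rfl | hk
  · simp
  obtain ⟨m, hm⟩ := h.symm.dvd
  have hk' : (k : ℝ) ≠ 0 := by positivity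
  have : (a : ℝ) / k = (b : ℝ) / k + m := by
    have : (a : ℝ) = b + k * m := by
      have : a = b + k * m := by linarith
      exact_mod_cast this
    rw [this]; field_simp
  rw [this, saw_add_intCast]

/-- The distribution relation of the sawtooth function. -/
lemma sum_saw_add_div (k : ℕ) (hk : 0 < k) (x : ℝ) :
    ∑ j ∈ Finset.range k, saw (x + j / k) = saw (k * x) := by
  have hk' : (0 : ℝ) < k := by positivity
  -- shifting `x` by `1 / k` does not change the sum
  have hshift : ∀ y : ℝ, ∑ j ∈ Finset.range k, saw (y + 1 / k + j / k) =
      ∑ j ∈ Finset.range k, saw (y + j / k) := by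
    intro y
    have h1 := Finset.sum_range_succ (fun j : ℕ => saw (y + j / k)) k
    have h2 := Finset.sum_range_succ' (fun j : ℕ => saw (y + j / k)) k
    have h3 : saw (y + (k : ℕ) / k) = saw (y + (0 : ℕ) / k) := by
      rw [div_self hk'.ne', Nat.cast_zero, zero_div, add_zero]
      simpa using saw_add_intCast y 1
    have h4 : ∀ j : ℕ, saw (y + 1 / k + j / k) = saw (y + (j + 1 : ℕ) / k) := by
      intro j; congr 1; push_cast; ring
    simp only [h4]
    linarith
  have hnat : ∀ (n : ℕ) (y : ℝ), ∑ j ∈ Finset.range k, saw (y + n / k + j / k) =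
      ∑ j ∈ Finset.range k, saw (y + j / k) := by
    intro n
    induction n with
    | zero => intro y; simp
    | succ n ih =>
      intro y
      rw [← ih y, ← hshift (y + n / k)]
      refine Finset.sum_congr rfl fun j _ => ?_
      congr 2; push_cast; ring
  have hint : ∀ (n : ℤ) (y : ℝ), ∑ j ∈ Finset.range k, saw (y + n / k + j / k) =
      ∑ j ∈ Finset.range k, saw (y + j / k) := by
    intro n y
    rcases Int.eq_nat_or_neg n with ⟨m, rfl | rfl⟩
    · simpa using hnat m y
    · have := hnat m (y + (-(m : ℤ) : ℤ) / k)
      rw [← this]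
      refine Finset.sum_congr rfl fun j _ => ?_
      congr 2; push_cast; ring
  -- Write `k x = n + u` with `0 ≤ u < 1`. The shift by `n / k` drops out, and all arguments `(u +
  -- j) / k` lie in `[0, 1)`, where the sawtooth is linear away from `0`.
  set n := ⌊(k : ℝ) * x⌋
  set u := Int.fract ((k : ℝ) * x) with hu
  have hx : x = u / k + n / k := by
    have : (k : ℝ) * x = n + u := (Int.floor_add_fract _).symm
    field_simp
    linarith
  have hu0 : 0 ≤ u := Int.fract_nonneg _
  have hu1 : u < 1 := Int.fract_lt_one _
  have hR : saw ((k : ℝ) * x) = if u = 0 then 0 else u - 1 / 2 := rfl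
  rw [hR, hx, hint]
  have hterm : ∀ j ∈ Finset.range k, saw (u / k + j / k) =
      if u = 0 ∧ j = 0 then 0 else (u + j) / k - 1 / 2 := by
    intro j hj
    have hj' : (j : ℝ) + 1 ≤ k := by exact_mod_cast Finset.mem_range.1 hj
    have hlt : u / k + j / k < 1 := by
      rw [← add_div, div_lt_one hk']; linarith
    split_ifs with h
    · simp [h.1, h.2, saw_zero]
    · rw [saw_eq _ hlt, add_div]
      have : 0 < u + j := by
        rcases hu0.lt_or_eq with h0 | h0
        · positivity
        · have : j ≠ 0 := fun hj => h ⟨h0.symm, hj⟩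
          have : (0 : ℝ) < j := by positivity
          linarith
      rw [← add_div]; positivity
  have hsum : ∑ j ∈ Finset.range k, ((u + j) / k - 1 / 2) = u - 1 / 2 := by
    have := Finset.sum_range_id_mul_two k
    have h2 : (∑ j ∈ Finset.range k, (j : ℝ)) * 2 = k * (k - 1) := by
      have : ((∑ j ∈ Finset.range k, j : ℕ) : ℝ) * 2 = k * ((k - 1 : ℕ) : ℝ) := by exact_mod_cast this
      rw [Nat.cast_sub hk] at this
      push_cast at this
      exact this
    rw [Finset.sum_sub_distrib, ← Finset.sum_div, Finset.sum_add_distrib]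
    simp only [Finset.sum_const, Finset.card_range, nsmul_eq_mul]
    field_simp
    linarith
  rw [Finset.sum_congr rfl hterm]
  split_ifs with h
  -- The term at argument `0` is `0`, while the linear formula gives `-1 / 2`; hence the correction.
  · have : ∀ j ∈ Finset.range k, (if u = 0 ∧ j = 0 then 0 else (u + j) / k - 1 / 2 : ℝ) =
        ((u + j) / k - 1 / 2) + if j = 0 then 1 / 2 else 0 := by
      intro j _
      by_cases hj : j = 0 <;> simp [h, hj]
    rw [Finset.sum_congr rfl this, Finset.sum_add_distrib, hsum, h]
    simp [hk]
  · simp only [h, false_and, if_false]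
    exact hsum

/-- The Dedekind sum `s(h, k)`. -/
def dedekindSum (h : ℤ) (k : ℕ) : ℝ :=
  ∑ r ∈ Finset.range k, saw ((r : ℝ) / k) * saw ((h * r : ℝ) / k)

lemma dedekindSum_congr {k : ℕ} {h h' : ℤ} (H : h ≡ h' [ZMOD k]) :
    dedekindSum h k = dedekindSum h' k := by
  refine Finset.sum_congr rfl fun r _ => ?_
  congr 1
  exact_mod_cast saw_intCast_div_congr (H.mul_right r)

lemma dedekindSum_neg (h : ℤ) (k : ℕ) : dedekindSum (-h) k = -dedekindSum h k := by
  unfold dedekindSum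
  rw [← Finset.sum_neg_distrib]
  refine Finset.sum_congr rfl fun r _ => ?_
  rw [← mul_neg, ← saw_neg]
  congr 2
  push_cast; ring

lemma dedekindSum_one (h : ℤ) : dedekindSum h 1 = 0 := by
  simp [dedekindSum, saw_zero]

lemma sum_range_mul_mod {h k : ℕ} (hk : 0 < k) (hc : Nat.Coprime h k) (g : ℕ → ℝ) :
    ∑ r ∈ Finset.range k, g (h * r % k) = ∑ r ∈ Finset.range k, g r := by
  have hmaps : Set.MapsTo (fun r => h * r % k) (Finset.range k) (Finset.range k) := by
    intro r _
    simpa using Nat.mod_lt _ hk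
  have hinj : Set.InjOn (fun r => h * r % k) (Finset.range k) := by
    intro r hr s hs hrs
    have : r ≡ s [MOD k] :=
      Nat.ModEq.cancel_left_of_coprime (by rwa [Nat.gcd_comm]) hrs
    exact Nat.ModEq.eq_of_lt_of_lt this (by simpa using hr) (by simpa using hs)
  have hbij := Finset.surjOn_of_injOn_of_card_le _ hmaps hinj le_rfl
  exact Finset.sum_bij (fun r _ => h * r % k) (fun r hr => hmaps hr)
    (fun r hr s hs => hinj hr hs) (fun s hs => by simpa using hbij hs) (fun _ _ => rfl)

lemma sum_range_cast (k : ℕ) : ∑ r ∈ Finset.range k, (r : ℝ) = k * (k - 1) / 2 := by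
  induction k with
  | zero => simp
  | succ k ih => rw [Finset.sum_range_succ, ih]; push_cast; ring

lemma sum_range_cast_sq (k : ℕ) :
    ∑ r ∈ Finset.range k, (r : ℝ) ^ 2 = k * (k - 1) * (2 * k - 1) / 6 := by
  induction k with
  | zero => simp
  | succ k ih => rw [Finset.sum_range_succ, ih]; push_cast; ring

lemma cast_mod_eq (n k : ℕ) : ((n % k : ℕ) : ℝ) = n - k * (n / k : ℕ) := by
  have : ((k * (n / k) + n % k : ℕ) : ℝ) = n := by rw [Nat.div_add_mod]
  push_cast at this
  linarith

/-- The Dedekind sum in terms of `∑ r ⌊h r / k⌋`. -/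
lemma dedekindSum_eq_floor {h k : ℕ} (hk : 0 < k) (hc : Nat.Coprime h k) :
    (k : ℝ) ^ 2 * dedekindSum h k = h * (k * (k - 1) * (2 * k - 1) / 6) -
      k * ∑ r ∈ Finset.range k, (r : ℝ) * (h * r / k : ℕ) - k ^ 2 * (k - 1) / 4 := by
  have hk' : (0 : ℝ) < k := by positivity
  -- The product of linear expressions is `k ^ 2 / 4` at `r = 0`, where the sawtooth product is `0`.
  -- By coprimality no other `r` meets a discontinuity.
  have hterm : ∀ r ∈ Finset.range k, (k : ℝ) ^ 2 * (saw ((r : ℝ) / k) *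
      saw (((h : ℤ) * r : ℝ) / k)) =
      (r - k / 2) * ((h * r % k : ℕ) - k / 2) - if r = 0 then (k : ℝ) ^ 2 / 4 else 0 := by
    intro r hr
    have hrk := Finset.mem_range.1 hr
    by_cases h0 : r = 0
    · simp [h0, saw_zero]; ring
    have hr0 : (0 : ℝ) < r := by positivity
    have hrk' : (r : ℝ) < k := by exact_mod_cast hrk
    have hmod : h * r % k ≠ 0 := by
      intro hd
      have : k ∣ r := (Nat.Coprime.dvd_mul_left hc.symm).1 (Nat.dvd_of_mod_eq_zero hd)
      exact absurd (Nat.le_of_dvd (Nat.pos_of_ne_zero h0) this) (by omega)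
    have hmod' : (0 : ℝ) < (h * r % k : ℕ) := by positivity
    have hmodk : ((h * r % k : ℕ) : ℝ) < k := by exact_mod_cast Nat.mod_lt _ hk
    have e : saw (((h : ℤ) * r : ℝ) / k) = ((h * r % k : ℕ) : ℝ) / k - 1 / 2 := by
      rw [← saw_eq (by positivity) ((div_lt_one hk').2 hmodk)]
      have : ((h * r : ℕ) : ℤ) ≡ ((h * r % k : ℕ) : ℤ) [ZMOD k] := by
        simpa using (Int.mod_modEq (h * r : ℤ) k).symm
      have := saw_intCast_div_congr this
      push_cast at this ⊢
      exact this
    rw [e, saw_eq (by positivity) ((div_lt_one hk').2 hrk'), if_neg h0]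
    field_simp
    ring
  have hA := sum_range_mul_mod hk hc (fun r => (r : ℝ))
  have hmul : ∀ r ∈ Finset.range k, ((r : ℝ) - k / 2) * ((h * r % k : ℕ) - k / 2) =
      h * (r : ℝ) ^ 2 - k * (r * (h * r / k : ℕ)) - k / 2 * r - k / 2 * (h * r % k : ℕ)
        + (k : ℝ) ^ 2 / 4 := by
    intro r _
    have := cast_mod_eq (h * r) k
    push_cast at this ⊢
    linear_combination (r : ℝ) * this
  rw [dedekindSum, Finset.mul_sum, Finset.sum_congr rfl hterm, Finset.sum_sub_distrib,
    Finset.sum_congr rfl hmul, Finset.sum_add_distrib, Finset.sum_sub_distrib,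
    Finset.sum_sub_distrib, Finset.sum_sub_distrib, ← Finset.mul_sum, ← Finset.mul_sum,
    ← Finset.mul_sum, ← Finset.mul_sum, hA, sum_range_cast, sum_range_cast_sq]
  simp [hk]
  ring

/-- A lattice point count: `n (n + 1)` is twice the sum of the `j ≤ n`, and the order of summation
is exchanged. It trades a quadratic floor sum modulo `k` for the linear floor sum modulo `h`, and is
the bridge between the two sides of reciprocity. -/
lemma sum_floor_sq {h k : ℕ} (hh : 0 < h) (hk : 0 < k) (hc : Nat.Coprime h k) :
    ∑ r ∈ Finset.range k, ((h * r / k : ℕ) : ℝ) * ((h * r / k : ℕ) + 1) =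
      2 * ∑ j ∈ Finset.range h, (j : ℝ) * (k - 1 - (k * j / h : ℕ)) := by
  have h1 : ∀ r ∈ Finset.range k, ((h * r / k : ℕ) : ℝ) * ((h * r / k : ℕ) + 1) =
      2 * ∑ j ∈ Finset.range h, if j ≤ h * r / k then (j : ℝ) else 0 := by
    intro r hr
    have hrk := Finset.mem_range.1 hr
    have hlt : h * r / k < h := by
      rw [Nat.div_lt_iff_lt_mul hk]
      exact Nat.mul_lt_mul_of_pos_left hrk hh
    rw [← Finset.sum_filter]
    have : (Finset.range h).filter (fun j => j ≤ h * r / k) = Finset.range (h * r / k + 1) := by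
      ext j; simp only [Finset.mem_filter, Finset.mem_range]; omega
    rw [this, sum_range_cast]
    push_cast; ring
  rw [Finset.sum_congr rfl h1, ← Finset.mul_sum, Finset.sum_comm]
  congr 1
  refine Finset.sum_congr rfl fun j hj => ?_
  have hjh := Finset.mem_range.1 hj
  rcases Nat.eq_zero_or_pos j with rfl | hj0
  · simp
  rw [← Finset.sum_filter, Finset.sum_const, nsmul_eq_mul, mul_comm]
  congr 1
  have hlt : k * j / h < k := by
    rw [Nat.div_lt_iff_lt_mul hh]
    exact Nat.mul_lt_mul_of_pos_left hjh hk
  have hset : (Finset.range k).filter (fun r => j ≤ h * r / k) = Finset.Ioo (k * j / h) k := by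
    ext r
    simp only [Finset.mem_filter, Finset.mem_range, Finset.mem_Ioo, Nat.le_div_iff_mul_le hk,
      Nat.div_lt_iff_lt_mul hh]
    constructor
    · rintro ⟨h1, h2⟩
      -- No lattice point lies on the diagonal: `h r = k j` with `0 < j < h` would give `h ∣ j`.
      refine ⟨lt_of_le_of_ne (by rw [mul_comm k, mul_comm r]; exact h2) fun he => ?_, h1⟩
      have : h ∣ j := (Nat.Coprime.dvd_mul_left hc).1 ⟨r, by rw [he, mul_comm]⟩
      exact absurd (Nat.le_of_dvd hj0 this) (by omega)
    · rintro ⟨h1, h2⟩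
      exact ⟨h2, by rw [mul_comm j, mul_comm h]; exact h1.le⟩
  rw [hset, Nat.card_Ioo, Nat.cast_sub (by omega), Nat.cast_sub hlt.le]
  push_cast; ring

/-- The reciprocity law for Dedekind sums. -/
theorem dedekindSum_reciprocity {h k : ℕ} (hh : 0 < h) (hk : 0 < k) (hc : Nat.Coprime h k) :
    dedekindSum h k + dedekindSum k h =
      -1 / 4 + ((h : ℝ) / k + (k : ℝ) / h + 1 / (h * k)) / 12 := by
  have hk' : (0 : ℝ) < k := by positivity
  have hh' : (0 : ℝ) < h := by positivity
  have e1 := dedekindSum_eq_floor hk hc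
  have e2 := dedekindSum_eq_floor hh hc.symm
  -- Since `r ↦ h r mod k` is a permutation, it preserves both `∑ r` and `∑ r ^ 2`. Inserting `h r
  -- mod k = h r - k ⌊h r / k⌋` gives two relations between floor sums.
  have hA := sum_range_mul_mod hk hc (fun r => (r : ℝ))
  have hB := sum_range_mul_mod hk hc (fun r => (r : ℝ) ^ 2)
  have hC := sum_floor_sq hh hk hc
  have hB' : ∀ r ∈ Finset.range k, ((h * r % k : ℕ) : ℝ) ^ 2 =
      (h : ℝ) ^ 2 * (r : ℝ) ^ 2 - 2 * h * k * (r * (h * r / k : ℕ)) +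
        (k : ℝ) ^ 2 * (((h * r / k : ℕ) : ℝ) * ((h * r / k : ℕ) + 1)) -
        (k : ℝ) ^ 2 * (h * r / k : ℕ) := by
    intro r _
    rw [cast_mod_eq]; push_cast; ring
  have hA' : ∀ r ∈ Finset.range k, ((h * r % k : ℕ) : ℝ) =
      (h : ℝ) * r - k * (h * r / k : ℕ) := by
    intro r _
    rw [cast_mod_eq]; push_cast; ring
  have hC' : ∀ j ∈ Finset.range h, (j : ℝ) * (k - 1 - (k * j / h : ℕ)) =
      (k - 1) * j - j * (k * j / h : ℕ) := fun j _ => by ring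
  beta_reduce at hA hB
  rw [Finset.sum_congr rfl hA', Finset.sum_sub_distrib, ← Finset.mul_sum, ← Finset.mul_sum,
    sum_range_cast] at hA
  rw [Finset.sum_congr rfl hB', Finset.sum_sub_distrib, Finset.sum_add_distrib,
    Finset.sum_sub_distrib, ← Finset.mul_sum, ← Finset.mul_sum, ← Finset.mul_sum,
    ← Finset.mul_sum, sum_range_cast_sq, hC, Finset.sum_congr rfl hC', Finset.sum_sub_distrib,
    ← Finset.mul_sum, sum_range_cast] at hB
  set F0 := ∑ r ∈ Finset.range k, ((h * r / k : ℕ) : ℝ)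
  set F1 := ∑ r ∈ Finset.range k, (r : ℝ) * (h * r / k : ℕ)
  set G1 := ∑ j ∈ Finset.range h, (j : ℝ) * (k * j / h : ℕ)
  set x := dedekindSum h k
  set y := dedekindSum k h
  have key : (h : ℝ) ^ 2 * (k : ℝ) ^ 2 * (x + y) = (h : ℝ) ^ 2 * (k : ℝ) ^ 2 *
      (-1 / 4 + ((h : ℝ) / k + (k : ℝ) / h + 1 / (h * k)) / 12) := by
    have : (h : ℝ) ^ 2 * (k : ℝ) ^ 2 *
      (-1 / 4 + ((h : ℝ) / k + (k : ℝ) / h + 1 / (h * k)) / 12) =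
      -((h : ℝ) ^ 2 * (k : ℝ) ^ 2) / 4 + (h ^ 3 * k + k ^ 3 * h + h * k) / 12 := by
      field_simp
    rw [this]
    -- This combination eliminates the three floor sums `F0`, `F1` and `G1`.
    linear_combination (h : ℝ) ^ 2 * e1 + (k : ℝ) ^ 2 * e2 + (h : ℝ) / 2 * hB - (h : ℝ) * k / 2 * hA
  exact mul_left_cancel₀ (by positivity) key

end EisHom

end

noncomputable section

namespace EisHom

/-! ## The primitive of `E₂` -/

lemma isOpen_im_pos : IsOpen {z : ℂ | 0 < z.im} :=
  isOpen_lt continuous_const Complex.continuous_im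

lemma eq_of_hasDerivAt_im_pos {F₁ F₂ f : ℂ → ℂ}
    (h₁ : ∀ z : ℂ, 0 < z.im → HasDerivAt F₁ (f z) z)
    (h₂ : ∀ z : ℂ, 0 < z.im → HasDerivAt F₂ (f z) z) {w : ℂ} (hw : 0 < w.im)
    (he : F₁ w = F₂ w) {z : ℂ} (hz : 0 < z.im) : F₁ z = F₂ z := by
  refine isOpen_im_pos.eqOn_of_deriv_eq (convex_halfSpace_im_gt 0).isPreconnected
    (fun x hx => (h₁ x hx).differentiableAt.differentiableWithinAt)
    (fun x hx => (h₂ x hx).differentiableAt.differentiableWithinAt)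
    (fun x hx => ?_) hw he hz
  rw [(h₁ x hx).deriv, (h₂ x hx).deriv]

lemma im_neg_inv_pos {z : ℂ} (hz : 0 < z.im) : 0 < (-z⁻¹).im := by
  have h0 : z ≠ 0 := fun h => by simp [h] at hz
  rw [Complex.neg_im, Complex.inv_im, neg_div, neg_neg]
  exact div_pos hz (Complex.normSq_pos.2 h0)

lemma div_I_mem_slitPlane {z : ℂ} (hz : 0 < z.im) : z / Complex.I ∈ Complex.slitPlane := by
  left
  simpa [Complex.div_I] using hz

/-- `E₂(-1/z) = z² E₂(z) + 6 z / (π i)`. -/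
lemma E2_neg_inv {z : ℂ} (hz : 0 < z.im) : EisensteinSeries.E2 (ofComplex (-z⁻¹)) =
    z ^ 2 * EisensteinSeries.E2 (ofComplex z) + 6 / (Real.pi * Complex.I) * z := by
  have h := E2_smul ModularGroup.S (ofComplex z)
  have e1 : ModularGroup.S • ofComplex z = ofComplex (-z⁻¹) := by
    refine UpperHalfPlane.ext ?_
    rw [modular_S_smul, ofComplex_apply_of_im_pos (im_neg_inv_pos hz),
      ofComplex_apply_of_im_pos hz]
    change (-z)⁻¹ = -z⁻¹
    rw [inv_neg]
  have e2 : denom ModularGroup.S (ofComplex z) = z := by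
    rw [ModularGroup.denom_apply, ofComplex_apply_of_im_pos hz]
    change ((1 : ℤ) : ℂ) * z + ((0 : ℤ) : ℂ) = z
    simp
  have e3 : (ModularGroup.S 1 0 : ℂ) = 1 := by
    change ((1 : ℤ) : ℂ) = 1
    simp
  rw [e1, e2, e3, riemannZeta_two] at h
  rw [h]
  have hpi : (Real.pi : ℂ) ≠ 0 := Complex.ofReal_ne_zero.2 Real.pi_ne_zero
  have hI := Complex.I_sq
  have hI0 := Complex.I_ne_zero
  field_simp
  linear_combination (-6 * z) * hI

lemma E2_add_one {z : ℂ} (hz : 0 < z.im) :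
    EisensteinSeries.E2 (ofComplex (z + 1)) = EisensteinSeries.E2 (ofComplex z) := by
  have h := E2_smul ModularGroup.T (ofComplex z)
  have hz1 : 0 < (z + 1).im := by simpa using hz
  have e1 : ModularGroup.T • ofComplex z = ofComplex (z + 1) := by
    refine UpperHalfPlane.ext ?_
    rw [modular_T_smul, ofComplex_apply_of_im_pos hz1, coe_vadd,
      ofComplex_apply_of_im_pos hz]
    push_cast
    ring
  have e2 : denom ModularGroup.T (ofComplex z) = 1 := by
    rw [ModularGroup.denom_apply]
    change ((0 : ℤ) : ℂ) * _ + ((1 : ℤ) : ℂ) = 1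
    simp
  have e3 : (ModularGroup.T 1 0 : ℂ) = 0 := by
    change ((0 : ℤ) : ℂ) = 0
    simp
  rw [e1, e2, e3] at h
  simpa using h

lemma exists_primitive_E2 : ∃ G : ℂ → ℂ, ∀ z : ℂ, 0 < z.im →
    HasDerivAt G (EisensteinSeries.E2 (ofComplex z)) z := by
  obtain ⟨G, hG⟩ := (convex_halfSpace_im_gt 0).exists_forall_hasDerivWithinAt E2_differentiableOn
  exact ⟨G, fun z hz => (hG z hz).hasDerivAt (isOpen_im_pos.mem_nhds hz)⟩

/-- `G` is a function on the upper half plane with the transformation behaviour of the primitive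
`12 / (π i) log η` of `E₂`. -/
structure IsLogEta (G : ℂ → ℂ) : Prop where
  neg_inv : ∀ z : ℂ, 0 < z.im →
    G (-z⁻¹) = G z + 6 / (Real.pi * Complex.I) * Complex.log (z / Complex.I)
  add_one : ∀ z : ℂ, 0 < z.im → G (z + 1) = G z + 1

/-- Quasi-modularity of `E₂` shows that both sides of each equation have the same derivative, so one
point suffices. For `neg_inv` this is `i`, which is fixed and where the logarithm vanishes. For
`add_one` no `q`-expansion is needed: as `ρ = -1 / (ρ + 1)`, the first equation at `ρ + 1` relates
`G ρ` to `G (ρ + 1)`. -/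
lemma isLogEta_of_primitive {G : ℂ → ℂ}
    (hG : ∀ z : ℂ, 0 < z.im → HasDerivAt G (EisensteinSeries.E2 (ofComplex z)) z) :
    IsLogEta G := by
  have hS : ∀ z : ℂ, 0 < z.im →
      G (-z⁻¹) = G z + 6 / (Real.pi * Complex.I) * Complex.log (z / Complex.I) := by
    intro z hz
    refine eq_of_hasDerivAt_im_pos (F₁ := fun z => G (-z⁻¹))
      (F₂ := fun z => G z + 6 / (Real.pi * Complex.I) * Complex.log (z / Complex.I))
      (f := fun z => EisensteinSeries.E2 (ofComplex z) + 6 / (Real.pi * Complex.I) * z⁻¹)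
      (fun x hx => ?_) (fun x hx => ?_) (w := Complex.I) (by simp) (by simp) hz
    · have h0 : x ≠ 0 := fun h => by simp [h] at hx
      have h1 := (hG _ (im_neg_inv_pos hx)).comp x (hasDerivAt_inv h0).neg
      refine h1.congr_deriv ?_
      rw [E2_neg_inv hx]
      field_simp
    · have h0 : x ≠ 0 := fun h => by simp [h] at hx
      have h1 := (((hasDerivAt_id x).div_const Complex.I).clog (div_I_mem_slitPlane hx)).const_mul
        (6 / (Real.pi * Complex.I))
      refine ((hG x hx).add h1).congr_deriv ?_
      simp only [id]
      have := Complex.I_ne_zero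
      field_simp
  refine ⟨hS, ?_⟩
  -- the constant is determined at the fixed point `ρ` of `S T`
  obtain ⟨ρ, hρ, hρim, hlog⟩ : ∃ ρ : ℂ, ρ = -(ρ + 1)⁻¹ ∧ 0 < ρ.im ∧
      Complex.log ((ρ + 1) / Complex.I) = -(Real.pi * Complex.I / 6) := by
    have hsq : ((√3 : ℝ) : ℂ) ^ 2 = 3 := by
      rw [← Complex.ofReal_pow, Real.sq_sqrt (by norm_num)]; norm_num
    have h3 : (0 : ℝ) < √3 := Real.sqrt_pos.2 (by norm_num)
    refine ⟨-1 / 2 + (√3 / 2 : ℝ) * Complex.I, ?_, ?_, ?_⟩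
    · have hne : (-1 / 2 + ((√3 / 2 : ℝ) : ℂ) * Complex.I + 1) ≠ 0 := by
        intro h
        have := congrArg Complex.re h
        simp at this
        norm_num at this
      rw [eq_comm, neg_eq_iff_eq_neg]
      refine inv_eq_of_mul_eq_one_right ?_
      push_cast
      linear_combination (-1 / 4 : ℂ) * Complex.I ^ 2 * hsq - (3 / 4 : ℂ) * Complex.I_sq
    · simp
    · have : (-1 / 2 + ((√3 / 2 : ℝ) : ℂ) * Complex.I + 1) / Complex.I =
          Complex.exp (-(Real.pi * Complex.I / 6)) := by
        have e : -((Real.pi : ℂ) * Complex.I / 6) = ((-(Real.pi / 6) : ℝ) : ℂ) * Complex.I := by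
          push_cast; ring
        rw [e, Complex.exp_mul_I, ← Complex.ofReal_cos, ← Complex.ofReal_sin, Real.cos_neg,
          Real.sin_neg, Real.cos_pi_div_six, Real.sin_pi_div_six, Complex.div_I]
        push_cast
        linear_combination (-(√3 : ℝ) / 2 : ℂ) * Complex.I_sq
      rw [this, Complex.log_exp]
      · simp; linarith [Real.pi_pos]
      · simp; linarith [Real.pi_pos]
  have hK : G (ρ + 1) = G ρ + 1 := by
    have h1 : 0 < (ρ + 1).im := by simpa using hρim
    have h2 := hS _ h1
    rw [← hρ, hlog] at h2
    have hpi : (Real.pi : ℂ) ≠ 0 := Complex.ofReal_ne_zero.2 Real.pi_ne_zero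
    have hI0 := Complex.I_ne_zero
    have h3 : 6 / ((Real.pi : ℂ) * Complex.I) * -(Real.pi * Complex.I / 6) = -1 := by
      field_simp
    rw [h3] at h2
    linear_combination -h2
  intro z hz
  refine eq_of_hasDerivAt_im_pos (F₁ := fun z => G (z + 1)) (F₂ := fun z => G z + 1)
    (fun x hx => ?_) (fun x hx => (hG x hx).add_const 1) hρim hK hz
  have h1 := (hG (x + 1) (by simpa using hx)).comp_add_const x 1
  rwa [E2_add_one hx] at h1

lemma IsLogEta.add_natCast {G : ℂ → ℂ} (hG : IsLogEta G) (n : ℕ) {z : ℂ} (hz : 0 < z.im) :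
    G (z + n) = G z + n := by
  induction n with
  | zero => simp
  | succ n ih =>
    push_cast
    rw [← add_assoc, hG.add_one _ (by simpa using hz), ih]
    ring

lemma IsLogEta.add_intCast {G : ℂ → ℂ} (hG : IsLogEta G) (n : ℤ) {z : ℂ} (hz : 0 < z.im) :
    G (z + n) = G z + n := by
  rcases Int.eq_nat_or_neg n with ⟨m, rfl | rfl⟩
  · exact_mod_cast hG.add_natCast m hz
  · have := hG.add_natCast m (z := z + (-(m : ℤ) : ℤ)) (by simpa using hz)
    push_cast at this ⊢
    rw [neg_add_cancel_right] at this
    rw [this]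
    ring

/-- Both sides have the same exponential, so they differ by `2 π i n`. Dividing by `I` rotates the
upper half plane to the right half plane, where arguments are below `π / 2` in absolute value; this
forces `-1 < n < 1`. -/
lemma log_div_I_add {w₁ w₂ : ℂ} (h₁ : 0 < w₁.im) (h₂ : 0 < w₂.im) (h : 0 < (w₁ * w₂).im) :
    Complex.log (w₁ / Complex.I) + Complex.log (w₂ / Complex.I) =
      Complex.log (w₁ * w₂ / Complex.I) - Real.pi * Complex.I / 2 := by
  have hre : ∀ w : ℂ, 0 < w.im → 0 < (w / Complex.I).re := fun w hw => by
    simpa [Complex.div_I] using hw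
  have harg : ∀ w : ℂ, 0 < w.im → |(Complex.log (w / Complex.I)).im| < Real.pi / 2 := fun w hw => by
    rw [Complex.log_im]; exact Complex.abs_arg_lt_pi_div_two_iff.2 (Or.inl (hre w hw))
  have hne : ∀ w : ℂ, 0 < w.im → w / Complex.I ≠ 0 := fun w hw h0 => by
    have := hre w hw; rw [h0] at this; simp at this
  have hexp : Complex.exp (Complex.log (w₁ / Complex.I) + Complex.log (w₂ / Complex.I)) =
      Complex.exp (Complex.log (w₁ * w₂ / Complex.I) - Real.pi * Complex.I / 2) := by
    rw [Complex.exp_add, Complex.exp_sub, Complex.exp_log (hne _ h₁), Complex.exp_log (hne _ h₂),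
      Complex.exp_log (hne _ h)]
    have : Complex.exp (Real.pi * Complex.I / 2) = Complex.I := by
      rw [show (Real.pi : ℂ) * Complex.I / 2 = (Real.pi / 2 : ℂ) * Complex.I by ring]
      exact Complex.exp_pi_div_two_mul_I
    rw [this]
    have hI := Complex.I_ne_zero
    field_simp
  obtain ⟨n, hn⟩ := Complex.exp_eq_exp_iff_exists_int.1 hexp
  have him := congrArg Complex.im hn
  have e : (n * (2 * Real.pi * Complex.I) : ℂ).im = n * (2 * Real.pi) := by simp
  have e' : ((Real.pi : ℂ) * Complex.I / 2).im = Real.pi / 2 := by simp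
  rw [Complex.add_im, Complex.add_im, Complex.sub_im, e, e'] at him
  have a1 := abs_lt.1 (harg _ h₁)
  have a2 := abs_lt.1 (harg _ h₂)
  have a3 := abs_lt.1 (harg _ h)
  have hpi := Real.pi_pos
  have hn1 : (-1 : ℝ) < n := by
    by_contra! hc
    nlinarith
  have hn2 : (n : ℝ) < 1 := by
    by_contra! hc
    nlinarith
  have hn0 : n = 0 := by
    have b1 : (-1 : ℤ) < n := by exact_mod_cast hn1
    have b2 : n < 1 := by exact_mod_cast hn2
    omega
  rw [hn, hn0]
  simp

lemma im_moebius_pos {a b c d : ℤ} (hdet : a * d - b * c = 1) {z : ℂ} (hz : 0 < z.im) :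
    0 < ((a * z + b) / (c * z + d) : ℂ).im := by
  let γ : SL(2, ℤ) := ⟨!![a, b; c, d], by rw [Matrix.det_fin_two_of]; exact hdet⟩
  have := UpperHalfPlane.im_pos (γ • (⟨z, hz⟩ : ℍ))
  rw [UpperHalfPlane.im, UpperHalfPlane.coe_specialLinearGroup_apply] at this
  simpa [γ] using this

/-- The transformation formula of `12 / (π i) log η` under a general modular transformation. -/
theorem IsLogEta.moebius {G : ℂ → ℂ} (hG : IsLogEta G) (c : ℕ) (hc : 0 < c) :
    ∀ (a b d : ℤ), a * d - b * c = 1 → ∀ z : ℂ, 0 < z.im →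
    G ((a * z + b) / (c * z + d)) = G z + (a + d : ℂ) / c - 12 * (dedekindSum a c : ℂ) +
      6 / (Real.pi * Complex.I) * Complex.log ((c * z + d) / Complex.I) := by
  -- Euclid's algorithm on the first column: translations reduce `a` modulo `c`, and `z ↦ -1/z` then
  -- exchanges the rows, so that the lower left entry becomes `a < c`.
  induction c using Nat.strong_induction_on with
  | _ c ih =>
  have hc0 : (c : ℂ) ≠ 0 := by exact_mod_cast hc.ne'
  -- reduction to `0 ≤ a < c`
  suffices H : ∀ (a : ℕ) (b d : ℤ), a < c → a * d - b * c = 1 → ∀ z : ℂ, 0 < z.im →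
      G ((a * z + b) / (c * z + d)) = G z + (a + d : ℂ) / c - 12 * (dedekindSum a c : ℂ) +
      6 / (Real.pi * Complex.I) * Complex.log ((c * z + d) / Complex.I) by
    intro a b d hdet z hz
    have hcz : (0 : ℤ) < c := by exact_mod_cast hc
    obtain ⟨r, hr⟩ := Int.eq_ofNat_of_zero_le (Int.emod_nonneg a hcz.ne')
    have hrc : r < c := by
      have := Int.emod_lt_of_pos a hcz
      omega
    set n := a / c with hn
    have ha : a = r + c * n := by
      rw [← hr]; exact (Int.emod_add_mul_ediv a c).symm
    have hdet' : (r : ℤ) * d - (b - n * d) * c = 1 := by rw [← hdet, ha]; ring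
    have h := H r (b - n * d) d hrc hdet' z hz
    have him := im_moebius_pos hdet' hz
    have hne : (c : ℂ) * z + d ≠ 0 := by
      intro h0
      have h0' := h0
      have := congrArg Complex.im h0
      simp [hc.ne', hz.ne'] at this
    have e : ((a : ℂ) * z + b) / (c * z + d) =
        ((r : ℤ) * z + (b - n * d : ℤ)) / ((c : ℤ) * z + d) + (n : ℤ) := by
      push_cast
      rw [div_add' _ _ _ hne]
      congr 1
      rw [ha]; push_cast; ring
    rw [e, hG.add_intCast n him]
    have hs : dedekindSum a c = dedekindSum r c := by
      refine dedekindSum_congr ?_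
      rw [ha]
      simp [Int.ModEq]
    push_cast at h ⊢
    rw [h, hs, ha]
    push_cast
    field_simp
    ring
  intro a b d hac hdet z hz
  have hwim : 0 < ((c : ℂ) * z + d).im := by simpa using mul_pos (Nat.cast_pos.2 hc) hz
  have hne : (c : ℂ) * z + d ≠ 0 := fun h0 => by rw [h0] at hwim; simp at hwim
  rcases Nat.eq_zero_or_pos a with rfl | ha
  · -- `a = 0`, so `c = 1` and `b = -1`
    have h1 : (c : ℤ) * (-b) = 1 := by rw [← hdet]; push_cast; ring
    have hc1 : (c : ℤ) = 1 := Int.eq_one_of_mul_eq_one_right (by positivity) h1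
    have hb : b = -1 := by rw [hc1] at h1; linarith
    have hc1' : c = 1 := by exact_mod_cast hc1
    subst hc1' hb
    have hzd : 0 < (z + d).im := by simpa using hz
    have h2 := hG.neg_inv _ hzd
    rw [hG.add_intCast d hz] at h2
    simp only [Nat.cast_zero, Nat.cast_one, zero_mul, one_mul, zero_add, Int.cast_neg,
      Int.cast_one, div_one, dedekindSum_one, Complex.ofReal_zero, mul_zero, sub_zero]
    rw [← h2, neg_div, one_div]
  · have ha0 : (a : ℂ) ≠ 0 := by exact_mod_cast ha.ne'
    -- The matrix of `-1 / γ z` has rows `(-c, -d)` and `(a, b)`, so the induction hypothesis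
    -- applies to it and produces `s(-c, a)`.
    have hdet' : (-(c : ℤ)) * b - (-d) * a = 1 := by rw [← hdet]; ring
    have h1 := ih a hac ha _ _ _ hdet' z hz
    have him := im_moebius_pos (c := c) hdet hz
    push_cast at him
    have h2 := hG.neg_inv _ him
    have hane : (a : ℂ) * z + b ≠ 0 := by
      intro h0
      rw [h0] at him; simp at him
    have e : -(((a : ℂ) * z + b) / (c * z + d))⁻¹ =
        ((-(c : ℤ) : ℤ) * z + (-d : ℤ)) / (a * z + b) := by
      push_cast
      rw [inv_div, ← neg_div]
      congr 1; ring
    rw [← e, h2] at h1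
    have hprod : ((a : ℂ) * z + b) / (c * z + d) * (c * z + d) = a * z + b :=
      div_mul_cancel₀ _ hne
    have h3 := log_div_I_add him hwim (by
      rw [hprod]; simpa using mul_pos (Nat.cast_pos.2 ha) hz)
    rw [hprod] at h3
    have hcop : Nat.Coprime a c := by
      rw [← Nat.isCoprime_iff_coprime]
      exact ⟨d, -b, by linarith⟩
    have hrec := dedekindSum_reciprocity ha hc hcop
    have hrec' : (dedekindSum a c : ℂ) + dedekindSum c a =
        -1 / 4 + ((a : ℂ) / c + (c : ℂ) / a + 1 / (a * c)) / 12 := by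
      have := congrArg (fun x : ℝ => (x : ℂ)) hrec
      push_cast at this
      exact this
    rw [dedekindSum_neg] at h1
    push_cast at h1
    have hpi : (Real.pi : ℂ) ≠ 0 := Complex.ofReal_ne_zero.2 Real.pi_ne_zero
    have hI0 := Complex.I_ne_zero
    have h4 : 6 / ((Real.pi : ℂ) * Complex.I) * (Real.pi * Complex.I / 2) = 3 := by
      field_simp; norm_num
    have hdetC : (a : ℂ) * d - b * c = 1 := by exact_mod_cast hdet
    have h5 : ((a : ℂ) + d) / c - (-c + b) / a = a / c + c / a + 1 / (a * c) := by
      field_simp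
      linear_combination hdetC
    -- The constant `3` from matching the branches of the logarithm is cancelled by `12 · (-1 / 4)`
    -- in the reciprocity law, and `h5` accounts for its rational terms.
    linear_combination h1 - (6 / ((Real.pi : ℂ) * Complex.I)) * h3 + h4 - h5 + 12 * hrec'

end EisHom

end

noncomputable section

namespace EisHom

/-! ## Eisenstein periods of closed geodesics -/

/-- The chosen lift of the geodesic runs from `w` to `γ w`, and the integral of an exact form only
sees the end points. -/
lemma capPairing_geodesicClass {N : ℕ} {g : ℍ → ℂ} (hg : InvariantForm N g) {H : ℂ → ℂ}
    (hH : ∀ z : ℍ, HasDerivAt H (g z) z) {γ : SL(2, ℤ)} (hγ : γ ∈ Gamma0 N)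
    (h : IsHyperbolic γ) : ∃ w : ℍ,
    capPairing (geodesicClass N γ hγ h) (formClass hg) = H ((γ • w : ℍ) : ℂ) - H w := by
  refine ⟨geodesicLift γ (Pi.single 0 1), ?_⟩
  have h1 : capPairing (geodesicClass N γ hγ h) (formClass hg) =
      simplexIntegral N g (geodesicSimplex N γ h) := by
    change chainIntegral N g (Finsupp.single (geodesicSimplex N γ h) 1) = _
    simp [chainIntegral]
  have e0 : edge 0 = Pi.single 0 1 := by ext j; fin_cases j <;> simp [edge]
  have e1 : edge 1 = Pi.single 1 1 := by ext j; fin_cases j <;> simp [edge]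
  rw [h1, hg.simplexIntegral_eq _ (h.isSmoothLift N), hg.lineIntegral_eq hH (h.isSmoothLift N),
    e0, e1, h.smul_geodesicLift]

lemma hasDerivAt_primitive_E2N {N : ℕ} [NeZero N] {G : ℂ → ℂ}
    (hG : ∀ z : ℂ, 0 < z.im → HasDerivAt G (EisensteinSeries.E2 (ofComplex z)) z) (z : ℍ) :
    HasDerivAt (fun w => (G (N * w) - G w) / (N - 1)) (E2N N z) z := by
  have hz : 0 < ((N : ℂ) * z).im := (mulPoint N z).im_pos
  have h1 := (hG _ hz).comp (z : ℂ) ((hasDerivAt_id (z : ℂ)).const_mul (N : ℂ))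
  refine ((h1.sub (hG z z.im_pos)).div_const ((N : ℂ) - 1)).congr_deriv ?_
  have e : ofComplex ((N : ℂ) * z) = mulPoint N z := by
    refine UpperHalfPlane.ext ?_
    rw [ofComplex_apply_of_im_pos hz]
    rfl
  rw [E2N_eq, e, ofComplex_apply]
  ring

/-- Conjugation by `diag(N, 1)` replaces the lower left entry `N k` by `k` and keeps the diagonal.
Both uses of `IsLogEta.moebius` involve the logarithm of the same `N k z + d`, so it cancels. -/
lemma IsLogEta.period {G : ℂ → ℂ} (hG : IsLogEta G) {N k : ℕ} (hN : 0 < N) (hk : 0 < k)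
    {a b d : ℤ} (hdet : a * d - b * (N * k) = 1) {z : ℂ} (hz : 0 < z.im) :
    (G (N * ((a * z + b) / ((N * k) * z + d))) - G ((a * z + b) / ((N * k) * z + d))) -
      (G (N * z) - G z) =
    (N - 1) * ((a + d) / (N * k)) + 12 * ((dedekindSum a (N * k) : ℂ) - dedekindSum a k) := by
  have h1 := hG.moebius (N * k) (Nat.mul_pos hN hk) a b d (by push_cast; exact hdet) z hz
  have hz' : 0 < ((N : ℂ) * z).im := by simpa using mul_pos (Nat.cast_pos.2 hN) hz
  have h2 := hG.moebius k hk a (N * b) d (by linarith) (N * z) hz'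
  have hN' : (N : ℂ) ≠ 0 := by exact_mod_cast hN.ne'
  have hk' : (k : ℂ) ≠ 0 := by exact_mod_cast hk.ne'
  have e1 : (N : ℂ) * ((a * z + b) / ((N * k) * z + d)) =
      (a * (N * z) + (N * b : ℤ)) / (k * (N * z) + d) := by
    rw [mul_div_assoc']
    congr 1 <;> push_cast <;> ring
  have e2 : (k : ℂ) * (N * z) + d = N * k * z + d := by ring
  rw [e1, h2, e2]
  push_cast at h1
  rw [h1]
  field_simp
  ring

/-- With lower left entry `t q`, the condition on `ψ(a) ∞` makes `t` divide the whole first column,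
hence the determinant `1`. So `t` is a sign, and `t ψ(a)` is the representative with lower left
entry `q` that `normTrace` refers to. -/
lemma DoubleCosetEmbedding.exists_sign {q : ℕ} [NeZero q] (ψ : DoubleCosetEmbedding q)
    (a : (ZMod q)ˣ) : ∃ (t n : ℤ), (t = 1 ∨ t = -1) ∧ ψ.toFun a 1 0 = t * q ∧
      ψ.toFun a 0 0 = t * ((a : ZMod q).val + n * q) := by
  obtain ⟨n, hn⟩ := ψ.smul_infty a
  have hc := (ψ.hyperbolic a).ne_zero
  have hmem := ψ.mem_Gamma0 a
  set γ := ψ.toFun a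
  have hq : (q : ℤ) ≠ 0 := by exact_mod_cast NeZero.ne q
  have hqQ : (q : ℚ) ≠ 0 := by exact_mod_cast NeZero.ne q
  rw [Gamma0_mem, ZMod.intCast_zmod_eq_zero_iff_dvd] at hmem
  obtain ⟨t, ht⟩ := hmem
  have hcQ : ((γ 1 0 : ℤ) : ℚ) ≠ 0 := by exact_mod_cast hc
  rw [OnePoint.smul_infty_eq_ite] at hn
  simp [hc, -ZMod.natCast_val] at hn
  have h0 : γ 0 0 = t * ((a : ZMod q).val + n * q) := by
    rw [div_eq_iff hcQ, ht] at hn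
    have : (γ 0 0 : ℚ) = t * ((a : ZMod q).val + n * q) := by
      rw [hn]; push_cast; field_simp
    exact_mod_cast this
  have hdet : γ 0 0 * γ 1 1 - γ 0 1 * γ 1 0 = 1 := by
    have := Matrix.det_fin_two γ.1
    rw [γ.2] at this
    exact this.symm
  refine ⟨t, n, ?_, by rw [ht]; ring, h0⟩
  refine Int.isUnit_iff.1 (isUnit_of_dvd_one ⟨((a : ZMod q).val + n * q) * γ 1 1 - γ 0 1 * q, ?_⟩)
  linear_combination -hdet + γ 1 1 * h0 - γ 0 1 * ht

/-- The Eisenstein period of `[𝒞_a^ψ(N)]`. -/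
theorem capPairing_homologyClass {N q : ℕ} [NeZero N] [NeZero q] (hN : 1 < N) (hNq : N ∣ q)
    (ψ : DoubleCosetEmbedding q) (a : (ZMod q)ˣ) :
    capPairing (ψ.homologyClass hNq a) (eisensteinClass N) =
      (normTrace (ψ.toFun a) : ℂ) / q + 12 / (N - 1) *
        ((dedekindSum (a : ZMod q).val q - dedekindSum (a : ZMod q).val (q / N) : ℝ) : ℂ) := by
  obtain ⟨G, hG⟩ := exists_primitive_E2
  have hE := isLogEta_of_primitive hG
  obtain ⟨w, hw⟩ := capPairing_geodesicClass (invariantForm_E2N N) (hasDerivAt_primitive_E2N hG)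
    (Gamma0_le_of_dvd hNq (ψ.mem_Gamma0 a)) (ψ.hyperbolic a)
  refine hw.trans ?_
  obtain ⟨t, n, ht, hc, ha⟩ := ψ.exists_sign a
  obtain ⟨k, hk⟩ := hNq
  have hq := NeZero.pos q
  have hN0 : 0 < N := by omega
  have hk0 : 0 < k := Nat.pos_of_ne_zero fun h => by simp [h] at hk; omega
  have hdiv : q / N = k := by rw [hk, Nat.mul_div_cancel_left _ hN0]
  set γ := ψ.toFun a
  have hdet : γ 0 0 * γ 1 1 - γ 0 1 * γ 1 0 = 1 := by
    have := Matrix.det_fin_two γ.1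
    rw [γ.2] at this
    exact this.symm
  have htt : t * t = 1 := by rcases ht with rfl | rfl <;> rfl
  have htC : (t : ℂ) * t = 1 := by exact_mod_cast htt
  have hqk : (q : ℤ) = N * k := by exact_mod_cast hk
  have hdet' : (t * γ 0 0) * (t * γ 1 1) - (t * γ 0 1) * (N * k) = 1 := by
    linear_combination (γ 0 0 * γ 1 1) * htt + hdet + γ 0 1 * hc + t * γ 0 1 * hqk
  have hp := hE.period hN0 hk0 hdet' w.im_pos
  have hqC : (q : ℂ) = N * k := by exact_mod_cast hk
  have hcoe : ((γ • w : ℍ) : ℂ) =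
      ((t * γ 0 0 : ℤ) * w + (t * γ 0 1 : ℤ)) / ((N * k) * w + (t * γ 1 1 : ℤ)) := by
    have ht0 : (t : ℂ) ≠ 0 := fun h => by rw [h] at htC; simp at htC
    rw [coe_specialLinearGroup_apply]
    simp only [algebraMap_int_eq, eq_intCast, Complex.ofReal_intCast]
    rw [← mul_div_mul_left _ _ ht0, hc, ← hqC]
    congr 1
    · push_cast; ring
    · push_cast
      linear_combination (q * w : ℂ) * htC
  have hs : ∀ m : ℕ, m ∣ q → dedekindSum (t * γ 0 0) m = dedekindSum (a : ZMod q).val m := by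
    intro m hm
    refine dedekindSum_congr ?_
    rw [ha, ← mul_assoc, htt, one_mul]
    obtain ⟨l, hl⟩ := hm
    refine (Int.modEq_iff_dvd.2 ⟨-(n * l), ?_⟩)
    have : (q : ℤ) = m * l := by exact_mod_cast hl
    rw [this]; ring
  have hN1 : (N : ℂ) - 1 ≠ 0 := by
    rw [sub_ne_zero]; exact_mod_cast hN.ne'
  have htr : (normTrace γ : ℂ) = (t * γ 0 0 : ℤ) + (t * γ 1 1 : ℤ) := by
    have : normTrace γ = t * γ 0 0 + t * γ 1 1 := by
      rw [normTrace, Matrix.trace_fin_two, hc, Int.sign_mul,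
        Int.sign_natCast_of_ne_zero (NeZero.ne q)]
      rcases ht with rfl | rfl
      · simp
      · simp; ring
    exact_mod_cast this
  rw [← hk, hs q dvd_rfl, hs k ⟨N, by rw [hk, mul_comm]⟩, ← htr, ← hqC] at hp
  rw [hqC] at hp
  rw [← hcoe] at hp
  rw [hdiv, ← sub_div, hp, hqC]
  push_cast
  field_simp

end EisHom

end

noncomputable section

namespace EisHom

/-! ## The value `L(1, χ)` of an odd primitive character -/

/-- A summable bound, uniform in `1 ≤ σ ≤ 2`, for letting `σ → 1⁺` in the conditionally convergent
series of the odd Hurwitz zeta function. It comes from writing the difference as `x ^ (-σ) (1 - (x /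
y) ^ σ)`. -/
lemma rpow_neg_sub_rpow_neg_le {x y σ : ℝ} (hx : 1 ≤ x) (hxy : x ≤ y) (hyx : y ≤ x + 1)
    (h1 : 1 ≤ σ) (h2 : σ ≤ 2) :
    0 ≤ x ^ (-σ) - y ^ (-σ) ∧ x ^ (-σ) - y ^ (-σ) ≤ 2 / x ^ 2 := by
  have hx0 : 0 < x := by linarith
  have hy0 : 0 < y := by linarith
  refine ⟨sub_nonneg.2 (Real.rpow_le_rpow_of_nonpos hx0 hxy (by linarith)), ?_⟩
  have e : y ^ (-σ) = x ^ (-σ) * (x / y) ^ σ := by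
    rw [Real.div_rpow hx0.le hy0.le, Real.rpow_neg hx0.le, Real.rpow_neg hy0.le]
    have := (Real.rpow_pos_of_pos hx0 σ).ne'
    field_simp
  have hq : (x / y) ^ (2 : ℝ) ≤ (x / y) ^ σ :=
    Real.rpow_le_rpow_of_exponent_ge (by positivity) ((div_le_one hy0).2 hxy) h2
  have hxs : x ^ (-σ) ≤ x⁻¹ := by
    rw [← Real.rpow_neg_one]
    exact Real.rpow_le_rpow_of_exponent_le hx (by linarith)
  rw [Real.rpow_two] at hq
  have h3 : 1 - (x / y) ^ 2 ≤ 2 / x := by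
    rw [div_pow, one_sub_div (by positivity), div_le_div_iff₀ (by positivity) hx0]
    nlinarith [mul_nonneg hx0.le hy0.le]
  have h4 : 0 ≤ 2 / x := by positivity
  calc x ^ (-σ) - y ^ (-σ) = x ^ (-σ) * (1 - (x / y) ^ σ) := by rw [e]; ring
    _ ≤ x ^ (-σ) * (2 / x) := by
        refine mul_le_mul_of_nonneg_left (by linarith) (Real.rpow_nonneg hx0.le _)
    _ ≤ x⁻¹ * (2 / x) := mul_le_mul_of_nonneg_right hxs h4
    _ = 2 / x ^ 2 := by field_simp

/-- The Dirichlet series is available only for `σ > 1`; dominated convergence and the continuity of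
the left side carry it to `σ = 1`. There it is a rearranged Mittag-Leffler expansion of the
cotangent. -/
lemma hurwitzZetaOdd_one {a : ℝ} (h0 : 0 < a) (h1 : a < 1) :
    HurwitzZeta.hurwitzZetaOdd (a : UnitAddCircle) 1 =
      Real.pi / 2 * Complex.cot (Real.pi * a) := by
  let f : ℝ → ℕ → ℂ := fun σ n =>
    (((((n + a : ℝ) ^ (-σ) - (n + 1 - a : ℝ) ^ (-σ)) / 2 : ℝ)) : ℂ)
  let B : ℕ → ℝ := fun n => if n = 0 then a ^ (-2 : ℝ) + (1 - a) ^ (-2 : ℝ) else 1 / (n : ℝ) ^ 2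
  have hb : 0 < 1 - a := by linarith
  have hB : Summable B := by
    rw [← summable_nat_add_iff 1]
    simp only [B, Nat.add_eq_zero_iff, one_ne_zero, and_false, if_false]
    exact (summable_nat_add_iff 1).2 (Real.summable_one_div_nat_pow.2 one_lt_two)
  have hbound : ∀ σ : ℝ, 1 ≤ σ → σ ≤ 2 → ∀ n, ‖f σ n‖ ≤ B n := by
    intro σ hσ1 hσ2 n
    rw [Complex.norm_real, Real.norm_eq_abs]
    rcases Nat.eq_zero_or_pos n with rfl | hn
    · simp only [B, if_true, Nat.cast_zero, zero_add]
      have e : ∀ x : ℝ, 0 < x → x < 1 → 0 < x ^ (-σ) ∧ x ^ (-σ) ≤ x ^ (-2 : ℝ) := fun x hx hx1 =>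
        ⟨Real.rpow_pos_of_pos hx _,
          Real.rpow_le_rpow_of_exponent_ge hx hx1.le (by linarith)⟩
      obtain ⟨p1, p2⟩ := e a h0 h1
      obtain ⟨p3, p4⟩ := e (1 - a) hb (by linarith)
      rw [abs_le]
      constructor <;> linarith
    · have hn1 : (1 : ℝ) ≤ n := by exact_mod_cast hn
      have hmono : ∀ x : ℝ, (n : ℝ) ≤ x → 2 / x ^ 2 ≤ 2 * (1 / (n : ℝ) ^ 2) := by
        intro x hx
        rw [mul_one_div]
        have : (n : ℝ) ^ 2 ≤ x ^ 2 := by gcongr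
        gcongr
      simp only [B, if_neg hn.ne']
      rcases le_total (n + a : ℝ) (n + 1 - a) with h | h
      · obtain ⟨p1, p2⟩ := rpow_neg_sub_rpow_neg_le (by linarith) h (by linarith) hσ1 hσ2
        have := hmono (n + a) (by linarith)
        rw [abs_le]
        constructor <;> linarith
      · obtain ⟨p1, p2⟩ := rpow_neg_sub_rpow_neg_le (by linarith) h (by linarith) hσ1 hσ2
        have := hmono (n + 1 - a) (by linarith)
        rw [abs_le]
        constructor <;> linarith
  have hsum : ∀ σ : ℝ, 1 < σ → HasSum (f σ) (HurwitzZeta.hurwitzZetaOdd (a : UnitAddCircle) σ) := by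
    intro σ hσ
    refine (HurwitzZeta.hasSum_nat_hurwitzZetaOdd_of_mem_Icc (a := a) ⟨h0.le, h1.le⟩
      (s := σ) (by simpa using hσ)).congr_fun fun n => ?_
    have hn : (0 : ℝ) ≤ n := Nat.cast_nonneg n
    simp only [f]
    push_cast
    rw [Complex.ofReal_cpow (by linarith), Complex.ofReal_cpow (by linarith)]
    push_cast
    rw [Complex.cpow_neg, Complex.cpow_neg, one_div, one_div]
  have hlim1 : Filter.Tendsto (fun σ : ℝ => ∑' n, f σ n) (nhdsWithin 1 (Set.Ioi 1))
      (nhds (∑' n, f 1 n)) := by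
    refine tendsto_tsum_of_dominated_convergence hB (fun n => ?_) ?_
    · have hc : ContinuousAt (fun σ => f σ n) 1 := by
        have hn : (0 : ℝ) ≤ n := Nat.cast_nonneg n
        have c1 : Continuous fun σ : ℝ => (n + a : ℝ) ^ (-σ) :=
          continuous_const.rpow continuous_neg fun _ => Or.inl (by linarith)
        have c2 : Continuous fun σ : ℝ => (n + 1 - a : ℝ) ^ (-σ) :=
          continuous_const.rpow continuous_neg fun _ => Or.inl (by linarith)
        exact (Complex.continuous_ofReal.comp ((c1.sub c2).div_const 2)).continuousAt
      exact hc.tendsto.mono_left nhdsWithin_le_nhds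
    · filter_upwards [Ioo_mem_nhdsGT (show (1 : ℝ) < 2 by norm_num)] with σ hσ n
      exact hbound σ hσ.1.le hσ.2.le n
  have hlim2 : Filter.Tendsto (fun σ : ℝ => ∑' n, f σ n) (nhdsWithin 1 (Set.Ioi 1))
      (nhds (HurwitzZeta.hurwitzZetaOdd (a : UnitAddCircle) 1)) := by
    have hc : ContinuousAt (fun σ : ℝ => HurwitzZeta.hurwitzZetaOdd (a : UnitAddCircle) σ) 1 :=
      ((HurwitzZeta.differentiable_hurwitzZetaOdd _).continuous.comp
        Complex.continuous_ofReal).continuousAt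
    have := hc.tendsto.mono_left (nhdsWithin_le_nhds (s := Set.Ioi 1))
    rw [Complex.ofReal_one] at this
    refine this.congr' ?_
    filter_upwards [self_mem_nhdsWithin] with σ hσ
    exact (hsum σ hσ).tsum_eq.symm
  rw [tendsto_nhds_unique hlim2 hlim1]
  have hS : Summable (f 1) := Summable.of_norm_bounded hB (hbound 1 le_rfl (by norm_num))
  have haC : (a : ℂ) ∈ Complex.integerComplement := by
    rintro ⟨n, hn⟩
    have hn' : (n : ℝ) = a := by exact_mod_cast hn
    have b1 : (0 : ℝ) < n := by rw [hn']; exact h0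
    have b2 : (n : ℝ) < 1 := by rw [hn']; exact h1
    have b3 : 0 < n := by exact_mod_cast b1
    have b4 : n < 1 := by exact_mod_cast b2
    omega
  have hcot := tendsto_logDeriv_euler_cot_sub haC
  -- The series `f` pairs `n + a` with `n + 1 - a`, while `cotTerm` pairs `a + (n + 1)` with `a - (n
  -- + 1)`. The partial sums differ by the boundary terms `1 / a` and `1 / (a + M)`.
  have hpart : ∀ M : ℕ, ∑ n ∈ Finset.range M, f 1 n =
      (1 / a + ∑ n ∈ Finset.range M, cotTerm a n - ((a + M : ℝ)⁻¹ : ℝ)) / 2 := by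
    intro M
    induction M with
    | zero => simp
    | succ M ih =>
      have hM : (0 : ℝ) ≤ M := Nat.cast_nonneg M
      have e1 : (a : ℂ) + M ≠ 0 := by
        have : (a + M : ℝ) ≠ 0 := by linarith
        exact_mod_cast this
      have e2 : (M : ℂ) + 1 - a ≠ 0 := by
        have : (M + 1 - a : ℝ) ≠ 0 := by linarith
        exact_mod_cast this
      have e3 : (a : ℂ) - (M + 1) ≠ 0 := by
        have : (a - (M + 1) : ℝ) ≠ 0 := by linarith
        exact_mod_cast this
      have e4 : (a : ℂ) + (M + 1) ≠ 0 := by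
        have : (a + (M + 1) : ℝ) ≠ 0 := by linarith
        exact_mod_cast this
      have e5 : (a : ℂ) - (M + 1) = -((M : ℂ) + 1 - a) := by ring
      rw [Finset.sum_range_succ, Finset.sum_range_succ, ih]
      simp only [f, cotTerm, Real.rpow_neg_one]
      push_cast
      rw [e5, add_comm (M : ℂ) a, one_div (-_), inv_neg, one_div ((a : ℂ) + (M + 1))]
      ring
  have hlim3 : Filter.Tendsto (fun M : ℕ => ∑ n ∈ Finset.range M, f 1 n) Filter.atTop
      (nhds ((1 / a + (Real.pi * Complex.cot (Real.pi * a) - 1 / a) - ((0 : ℝ) : ℂ)) / 2)) := by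
    simp only [hpart]
    refine ((hcot.const_add _).sub ?_).div_const 2
    refine (Complex.continuous_ofReal.tendsto 0).comp ?_
    exact tendsto_inv_atTop_zero.comp
      (Filter.tendsto_atTop_add_const_left _ a tendsto_natCast_atTop_atTop)
  rw [tendsto_nhds_unique hS.hasSum.tendsto_sum_nat hlim3]
  push_cast
  ring

variable {c : ℕ} [NeZero c]

lemma sum_zmod_eq_sum_range (F : ℕ → ℂ) :
    ∑ b : ZMod c, F b.val = ∑ b ∈ Finset.range c, F b := by
  refine Finset.sum_bij (fun b _ => b.val) (fun b _ => Finset.mem_range.2 (ZMod.val_lt b))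
    (fun b _ b' _ h => ZMod.val_injective c h) (fun b hb => ?_) (fun _ _ => rfl)
  exact ⟨b, Finset.mem_univ _, ZMod.val_cast_of_lt (Finset.mem_range.1 hb)⟩

lemma saw_val_neg (b : ZMod c) : saw (((-b).val : ℝ) / c) = -saw ((b.val : ℝ) / c) := by
  rw [← saw_neg, ← neg_div]
  have h : ((-b).val : ℤ) ≡ -(b.val : ℤ) [ZMOD c] := by
    rw [← ZMod.intCast_eq_intCast_iff]
    push_cast
    rw [ZMod.natCast_zmod_val, ZMod.natCast_zmod_val]
  have := saw_intCast_div_congr h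
  push_cast at this
  exact this

/-- The sawtooth function is the finite Fourier transform of the cotangent. -/
lemma sum_stdAddChar_mul_saw {k : ZMod c} (hk : k ≠ 0) :
    ∑ b : ZMod c, ZMod.stdAddChar (b * k) * (saw ((b.val : ℝ) / c) : ℂ) =
      -Complex.I / 2 * Complex.cot (Real.pi * ((k.val / c : ℝ) : ℂ)) := by
  have hc0 : (0 : ℝ) < c := Nat.cast_pos.2 (NeZero.pos c)
  have hcC : (c : ℂ) ≠ 0 := Nat.cast_ne_zero.2 (NeZero.ne c)
  set z : ℂ := ZMod.stdAddChar k with hz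
  have hz1 : z ≠ 1 := by
    intro h
    rw [hz, ← AddChar.map_zero_eq_one (ZMod.stdAddChar (N := c))] at h
    exact hk (ZMod.injective_stdAddChar h)
  have hzc : z ^ c = 1 := by
    rw [hz, ← AddChar.map_nsmul_eq_pow]
    simp
  have hzexp : z = Complex.exp (2 * Real.pi * Complex.I * ((k.val / c : ℝ) : ℂ)) := by
    have := ZMod.stdAddChar_coe (N := c) (k.val : ℤ)
    rw [Int.cast_natCast, ZMod.natCast_zmod_val] at this
    rw [hz, this]
    congr 1
    push_cast
    ring
  have hpow : ∀ b : ZMod c, ZMod.stdAddChar (b * k) = z ^ b.val := by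
    intro b
    rw [hz, ← AddChar.map_nsmul_eq_pow, nsmul_eq_mul, ZMod.natCast_zmod_val]
  simp only [hpow]
  rw [sum_zmod_eq_sum_range (fun b => z ^ b * (saw ((b : ℝ) / c) : ℂ))]
  -- The last summand corrects the value at `b = 0`, where the sawtooth is `0` and not `-1 / 2`.
  have hterm : ∀ b ∈ Finset.range c, z ^ b * (saw ((b : ℝ) / c) : ℂ) =
      (c : ℂ)⁻¹ * (b * z ^ b) - 1 / 2 * z ^ b + if b = 0 then 1 / 2 else 0 := by
    intro b hb
    have hbc : (b : ℝ) < c := by exact_mod_cast Finset.mem_range.1 hb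
    by_cases h0 : b = 0
    · simp [h0, saw_zero]
    · have : (0 : ℝ) < b := by positivity
      rw [saw_eq (by positivity) ((div_lt_one hc0).2 hbc), if_neg h0]
      push_cast
      field_simp
      ring
  have hgeom : ∑ b ∈ Finset.range c, z ^ b = 0 := by
    have := mul_geom_sum z c
    rw [hzc, sub_self] at this
    exact (mul_eq_zero.1 this).resolve_left (sub_ne_zero.2 hz1)
  have harith : (z - 1) * ∑ b ∈ Finset.range c, (b : ℂ) * z ^ b = c := by
    have aux : ∀ m : ℕ, (z - 1) * ∑ b ∈ Finset.range m, (b : ℂ) * z ^ b =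
        m * z ^ m - z * ∑ b ∈ Finset.range m, z ^ b := by
      intro m
      induction m with
      | zero => simp
      | succ m ih =>
        rw [Finset.sum_range_succ, Finset.sum_range_succ, mul_add, ih]
        push_cast
        ring
    rw [aux, hgeom, hzc]
    simp
  have hz1' : z - 1 ≠ 0 := sub_ne_zero.2 hz1
  have hz1'' : 1 - z ≠ 0 := sub_ne_zero.2 hz1.symm
  rw [Finset.sum_congr rfl hterm, Finset.sum_add_distrib, Finset.sum_sub_distrib,
    ← Finset.mul_sum, ← Finset.mul_sum, hgeom, eq_div_of_mul_eq hz1' ((mul_comm _ _).trans harith),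
    Complex.cot_pi_eq_exp_ratio, ← hzexp]
  have hI := Complex.I_ne_zero
  rw [Finset.sum_ite_eq' (Finset.range c) 0, if_pos (Finset.mem_range.2 (NeZero.pos c))]
  field_simp
  ring

lemma hurwitzZetaOdd_toAddCircle_one (k : ZMod c) :
    HurwitzZeta.hurwitzZetaOdd (ZMod.toAddCircle k) 1 =
      Real.pi * Complex.I * ∑ b : ZMod c, ZMod.stdAddChar (b * k) * (saw ((b.val : ℝ) / c) : ℂ) := by
  -- At `k = 0` the cotangent has a pole, but both sides vanish by oddness.
  rcases eq_or_ne k 0 with rfl | hk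
  · have h1 : ∑ b : ZMod c, (saw ((b.val : ℝ) / c) : ℂ) = 0 := by
      have h2 := Fintype.sum_equiv (Equiv.neg (ZMod c))
        (fun b : ZMod c => (saw (((-b).val : ℝ) / c) : ℂ))
        (fun b : ZMod c => (saw ((b.val : ℝ) / c) : ℂ)) (fun _ => rfl)
      simp only [saw_val_neg, Complex.ofReal_neg, Finset.sum_neg_distrib] at h2
      linear_combination (-1 / 2 : ℂ) * h2
    have h3 := HurwitzZeta.hurwitzZetaOdd_neg 0 1
    rw [neg_zero] at h3
    simp only [map_zero, mul_zero, AddChar.map_zero_eq_one, one_mul, h1]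
    linear_combination (1 / 2 : ℂ) * h3
  · have hc0 : (0 : ℝ) < c := Nat.cast_pos.2 (NeZero.pos c)
    have hv : 0 < k.val := Nat.pos_of_ne_zero ((ZMod.val_ne_zero k).2 hk)
    have h0 : (0 : ℝ) < k.val / c := by positivity
    have h1 : (k.val : ℝ) / c < 1 := by
      rw [div_lt_one hc0]; exact_mod_cast ZMod.val_lt k
    rw [sum_stdAddChar_mul_saw hk, ZMod.toAddCircle_apply, hurwitzZetaOdd_one h0 h1]
    linear_combination (Real.pi / 2 * Complex.cot (Real.pi * ((k.val / c : ℝ) : ℂ))) *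
      Complex.I_sq

/-- The Fourier transform of a primitive character is a Gauss sum times the reflected inverse
character. Transforming twice multiplies by `c` up to reflection, and the value at `-1` is `τ * conj
τ`. -/
lemma norm_gaussSum_sq {χ : DirichletCharacter ℂ c} (hχ : χ.IsPrimitive) :
    ‖gaussSum χ ZMod.stdAddChar‖ ^ 2 = c := by
  set τ := gaussSum χ (ZMod.stdAddChar (N := c)) with hτ
  -- Fourier inversion, evaluated at `-1`
  have h1 := congrFun (ZMod.dft_dft (χ : ZMod c → ℂ)) (-1)
  rw [ZMod.dft_apply] at h1
  simp only [hχ.fourierTransform_eq_inv_mul_gaussSum, smul_eq_mul, mul_neg, neg_neg, map_one, mul_one,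
    ← hτ] at h1
  have h2 : conj τ = ∑ j : ZMod c, ZMod.stdAddChar j * χ⁻¹ (-j) := by
    have h3 := star_gaussSum_eq χ (ZMod.stdAddChar (N := c))
    rw [← hτ] at h3
    change star τ = _
    rw [h3, gaussSum]
    refine Fintype.sum_equiv (Equiv.neg (ZMod c)) _ _ fun j => ?_
    simp only [Equiv.neg_apply, neg_neg]
    rw [mul_comm, AddChar.inv_apply]
  have h4 : τ * conj τ = c := by
    rw [h2, ← h1, Finset.mul_sum]
    exact Finset.sum_congr rfl fun j _ => by ring
  rw [Complex.mul_conj, Complex.normSq_eq_norm_sq] at h4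
  exact_mod_cast h4

/-- The first generalized Bernoulli number of an odd primitive character. -/
theorem norm_sum_mul_saw_sq {χ : DirichletCharacter ℂ c} (hχ : χ.IsPrimitive) (ho : χ.Odd) :
    ‖∑ b ∈ Finset.range c, χ (b : ZMod c) * (saw ((b : ℝ) / c) : ℂ)‖ ^ 2 =
      c * ‖DirichletCharacter.LFunction χ 1‖ ^ 2 / Real.pi ^ 2 := by
  have hc0 : (0 : ℝ) < c := Nat.cast_pos.2 (NeZero.pos c)
  set T := ∑ b ∈ Finset.range c, χ (b : ZMod c) * (saw ((b : ℝ) / c) : ℂ) with hT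
  have hT' : conj T = ∑ b : ZMod c, χ⁻¹ b * (saw ((b.val : ℝ) / c) : ℂ) := by
    rw [hT, ← sum_zmod_eq_sum_range (fun b => χ (b : ZMod c) * (saw ((b : ℝ) / c) : ℂ)), map_sum]
    refine Finset.sum_congr rfl fun b _ => ?_
    rw [map_mul, Complex.conj_ofReal, ZMod.natCast_zmod_val, ← MulChar.star_apply']
    rfl
  -- Expand `L(1, χ)` in odd Hurwitz zeta values, insert their finite Fourier expansion and exchange
  -- the sums. By primitivity the inner sum is `χ⁻¹ b` times the Gauss sum for every `b`, unit or
  -- not.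
  have hL : DirichletCharacter.LFunction χ 1 =
      Real.pi * Complex.I / c * (gaussSum χ ZMod.stdAddChar * conj T) := by
    rw [DirichletCharacter.LFunction, ZMod.LFunction_def_odd ho.to_fun]
    simp only [hurwitzZetaOdd_toAddCircle_one]
    rw [Complex.cpow_neg_one, hT']
    have e : ∀ j : ZMod c, χ j * (Real.pi * Complex.I *
        ∑ b : ZMod c, ZMod.stdAddChar (b * j) * (saw ((b.val : ℝ) / c) : ℂ)) =
        Real.pi * Complex.I *
          ∑ b : ZMod c, (χ j * ZMod.stdAddChar (b * j)) * (saw ((b.val : ℝ) / c) : ℂ) := by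
      intro j
      rw [mul_left_comm, Finset.mul_sum (a := χ j)]
      simp only [mul_assoc]
    simp only [e]
    rw [← Finset.mul_sum, Finset.sum_comm]
    have e2 : ∀ b : ZMod c, ∑ j : ZMod c, χ j * ZMod.stdAddChar (b * j) *
        (saw ((b.val : ℝ) / c) : ℂ) =
        gaussSum χ ZMod.stdAddChar * (χ⁻¹ b * (saw ((b.val : ℝ) / c) : ℂ)) := by
      intro b
      rw [← Finset.sum_mul]
      have := gaussSum_mulShift_of_isPrimitive (ZMod.stdAddChar (N := c)) hχ b
      rw [gaussSum] at this
      simp only [AddChar.mulShift_apply] at this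
      rw [this]
      ring
    simp only [e2]
    rw [← Finset.mul_sum]
    ring
  have hg := norm_gaussSum_sq hχ
  rw [hL, norm_mul, norm_mul, mul_pow, mul_pow, hg, Complex.norm_conj, norm_div, norm_mul,
    Complex.norm_I, Complex.norm_real, Complex.norm_natCast, Real.norm_eq_abs,
    abs_of_pos Real.pi_pos]
  have := Real.pi_ne_zero
  field_simp

end EisHom

end

noncomputable section

namespace EisHom

/-! ## Character sums of Dedekind sums -/

/-- Each fraction `r / m` is put into lowest terms `u / d`. -/
lemma sum_range_div_eq_sum_divisors {m : ℕ} (hm : 0 < m) (F : ℝ → ℝ) :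
    ∑ r ∈ Finset.range m, F (r / m) =
      ∑ d ∈ m.divisors, ∑ u ∈ (Finset.range d).filter (Nat.Coprime · d), F (u / d) := by
  rw [Finset.sum_sigma']
  refine Finset.sum_bij' (fun r _ => ⟨m / r.gcd m, r / r.gcd m⟩) (fun x _ => x.2 * (m / x.1))
    ?_ ?_ ?_ ?_ ?_
  · intro r hr
    have hrm := Finset.mem_range.1 hr
    have hg : 0 < r.gcd m := Nat.gcd_pos_of_pos_right _ hm
    simp only [Finset.mem_sigma, Nat.mem_divisors, Finset.mem_filter, Finset.mem_range]
    refine ⟨⟨Nat.div_dvd_of_dvd (Nat.gcd_dvd_right _ _), hm.ne'⟩, ?_, ?_⟩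
    · exact Nat.div_lt_div_of_lt_of_dvd (Nat.gcd_dvd_right _ _) hrm
    · exact Nat.coprime_div_gcd_div_gcd hg
  · rintro ⟨d, u⟩ hx
    simp only [Finset.mem_sigma, Nat.mem_divisors, Finset.mem_filter, Finset.mem_range] at hx
    obtain ⟨⟨⟨k, rfl⟩, -⟩, hu, -⟩ := hx
    have hd : 0 < d := Nat.pos_of_mul_pos_right hm
    have hk : 0 < k := Nat.pos_of_mul_pos_left hm
    rw [Finset.mem_range, Nat.mul_div_cancel_left _ hd]
    exact Nat.mul_lt_mul_of_pos_right hu hk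
  · intro r hr
    have hg : 0 < r.gcd m := Nat.gcd_pos_of_pos_right _ hm
    dsimp only
    rw [Nat.div_div_self (Nat.gcd_dvd_right _ _) hm.ne',
      Nat.div_mul_cancel (Nat.gcd_dvd_left _ _)]
  · rintro ⟨d, u⟩ hx
    simp only [Finset.mem_sigma, Nat.mem_divisors, Finset.mem_filter, Finset.mem_range] at hx
    obtain ⟨⟨⟨k, rfl⟩, -⟩, hu, hc⟩ := hx
    have hd : 0 < d := Nat.pos_of_mul_pos_right hm
    have hk : 0 < k := Nat.pos_of_mul_pos_left hm
    dsimp only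
    have hg : (u * (d * k / d)).gcd (d * k) = k := by
      rw [Nat.mul_div_cancel_left _ hd, Nat.gcd_mul_right, hc.gcd_eq_one, one_mul]
    rw [hg, Nat.mul_div_cancel_left _ hd, Nat.mul_div_cancel _ hk, Nat.mul_div_cancel _ hk]
  · intro r hr
    have hg : 0 < r.gcd m := Nat.gcd_pos_of_pos_right _ hm
    have hg' : ((r.gcd m : ℕ) : ℝ) ≠ 0 := by exact_mod_cast hg.ne'
    dsimp only
    rw [Nat.cast_div (Nat.gcd_dvd_left _ _) hg', Nat.cast_div (Nat.gcd_dvd_right _ _) hg',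
      div_div_div_cancel_right₀ hg']

lemma sum_filter_coprime_eq_sum_units {d : ℕ} [NeZero d] {M : Type*} [AddCommMonoid M]
    (F : ℕ → M) : ∑ u ∈ (Finset.range d).filter (Nat.Coprime · d), F u =
      ∑ u : (ZMod d)ˣ, F (u : ZMod d).val := by
  symm
  refine Finset.sum_bij (fun u _ => (u : ZMod d).val) (fun u _ => ?_) (fun u _ v _ h => ?_)
    (fun b hb => ?_) (fun _ _ => rfl)
  · exact Finset.mem_filter.2 ⟨Finset.mem_range.2 (ZMod.val_lt _), ZMod.val_coe_unit_coprime u⟩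
  · exact Units.ext (ZMod.val_injective d h)
  · obtain ⟨h1, h2⟩ := Finset.mem_filter.1 hb
    refine ⟨ZMod.unitOfCoprime b h2, Finset.mem_univ _, ?_⟩
    rw [ZMod.coe_unitOfCoprime, ZMod.val_cast_of_lt (Finset.mem_range.1 h1)]

/-- The part of `s(h, m)` of exact denominator `d`. -/
def primitiveDedekindSum (h : ℤ) (d : ℕ) : ℝ :=
  ∑ u ∈ (Finset.range d).filter (Nat.Coprime · d), saw ((u : ℝ) / d) * saw (h * ((u : ℝ) / d))

lemma dedekindSum_eq_sum_divisors (h : ℤ) {m : ℕ} (hm : 0 < m) :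
    dedekindSum h m = ∑ d ∈ m.divisors, primitiveDedekindSum h d := by
  have := sum_range_div_eq_sum_divisors hm (fun x => saw x * saw (h * x))
  rw [dedekindSum]
  simp only [mul_div_assoc]
  exact this

/-- The twisted sum `∑ χ(u) ((u / d))` over the units modulo `d`. -/
def sawSum {c : ℕ} (χ : DirichletCharacter ℂ c) (d : ℕ) : ℂ :=
  ∑ u ∈ (Finset.range d).filter (Nat.Coprime · d), χ (u : ZMod c) * (saw ((u : ℝ) / d) : ℂ)

/-- Reduction of units is surjective with fibres of equal size. Evaluating one double sum of
translates in both orders avoids counting the fibres. -/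
lemma sum_units_unitsMap {q d : ℕ} [NeZero q] [NeZero d] (h : d ∣ q) (H : (ZMod d)ˣ → ℂ) :
    (d.totient : ℂ) * ∑ a : (ZMod q)ˣ, H (ZMod.unitsMap h a) =
      q.totient * ∑ v : (ZMod d)ˣ, H v := by
  have h1 : ∑ v : (ZMod d)ˣ, ∑ a : (ZMod q)ˣ, H (ZMod.unitsMap h a * v) =
      d.totient * ∑ a : (ZMod q)ˣ, H (ZMod.unitsMap h a) := by
    have : ∀ v : (ZMod d)ˣ, ∑ a : (ZMod q)ˣ, H (ZMod.unitsMap h a * v) =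
        ∑ a : (ZMod q)ˣ, H (ZMod.unitsMap h a) := by
      intro v
      obtain ⟨b, rfl⟩ := ZMod.unitsMap_surjective h v
      exact Fintype.sum_equiv (Equiv.mulRight b) _ _ fun a => by simp
    simp only [this, Finset.sum_const, Finset.card_univ, ZMod.card_units_eq_totient, nsmul_eq_mul]
  have h2 : ∑ a : (ZMod q)ˣ, ∑ v : (ZMod d)ˣ, H (ZMod.unitsMap h a * v) =
      q.totient * ∑ v : (ZMod d)ˣ, H v := by
    have : ∀ a : (ZMod q)ˣ, ∑ v : (ZMod d)ˣ, H (ZMod.unitsMap h a * v) =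
        ∑ v : (ZMod d)ˣ, H v := fun a =>
      Fintype.sum_equiv (Equiv.mulLeft (ZMod.unitsMap h a)) _ _ fun v => by simp
    simp only [this, Finset.sum_const, Finset.card_univ, ZMod.card_units_eq_totient, nsmul_eq_mul]
  rw [← h1, Finset.sum_comm, h2]

/-- This exhibits the primitive part as an autocorrelation on the group `(ℤ/dℤ)ˣ`, depending on `a`
only through its reduction modulo `d`. -/
lemma primitiveDedekindSum_eq_sum_units {q d : ℕ} [NeZero q] [NeZero d] (h : d ∣ q)
    (a : (ZMod q)ˣ) : primitiveDedekindSum (a : ZMod q).val d =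
      ∑ u : (ZMod d)ˣ, saw (((u : ZMod d).val : ℝ) / d) *
        saw ((((ZMod.unitsMap h a * u : (ZMod d)ˣ) : ZMod d).val : ℝ) / d) := by
  rw [primitiveDedekindSum, sum_filter_coprime_eq_sum_units
    (fun u : ℕ => saw ((u : ℝ) / d) * saw ((((a : ZMod q).val : ℤ) : ℝ) * ((u : ℝ) / d)))]
  refine Finset.sum_congr rfl fun u _ => ?_
  congr 1
  have e : ((a : ZMod q).val * (u : ZMod d).val : ℤ) ≡
      ((ZMod.unitsMap h a * u : (ZMod d)ˣ) : ZMod d).val [ZMOD d] := by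
    rw [← ZMod.intCast_eq_intCast_iff]
    push_cast
    rw [ZMod.natCast_zmod_val, ZMod.natCast_zmod_val, ZMod.unitsMap_val]
    simp
  have := saw_intCast_div_congr e
  push_cast at this ⊢
  rw [mul_div_assoc] at this
  exact this

/-- The twisted sum of primitive Dedekind sums. -/
lemma sum_conj_mul_primitiveDedekindSum {q d : ℕ} [NeZero q] [NeZero d] (hd : d ∣ q)
    (χ : DirichletCharacter ℂ q) :
    ∑ a : (ZMod q)ˣ, conj (χ (a : ZMod q)) * (primitiveDedekindSum (a : ZMod q).val d : ℂ) =
      if χ.conductor ∣ d then (q.totient : ℂ) / d.totient *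
        (‖sawSum χ.primitiveCharacter d‖ : ℂ) ^ 2 else 0 := by
  set g : (ZMod d)ˣ → ℂ := fun u => (saw (((u : ZMod d).val : ℝ) / d) : ℂ) with hg
  have e1 : ∀ a : (ZMod q)ˣ, (primitiveDedekindSum (a : ZMod q).val d : ℂ) =
      ∑ u, g u * g (ZMod.unitsMap hd a * u) := by
    intro a
    rw [primitiveDedekindSum_eq_sum_units hd]
    push_cast
    rfl
  simp only [e1]
  split_ifs with hc
  · set χ' := χ.primitiveCharacter
    -- the character modulo `d`
    set ξ : (ZMod d)ˣ → ℂ := fun v => χ' ((ZMod.unitsMap hc v : (ZMod χ.conductor)ˣ) :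
      ZMod χ.conductor) with hξ
    have hξmul : ∀ u v, ξ (u * v) = ξ u * ξ v := fun u v => by simp [hξ]
    have hξone : ∀ v, ξ v * conj (ξ v) = 1 := fun v => by
      rw [Complex.mul_conj, Complex.normSq_eq_norm_sq, χ'.unit_norm_eq_one]
      simp
    have hχ : ∀ a : (ZMod q)ˣ, χ (a : ZMod q) = ξ (ZMod.unitsMap hd a) := by
      intro a
      conv_lhs => rw [← χ.changeLevel_primitiveCharacter]
      rw [DirichletCharacter.changeLevel_eq_cast_of_dvd]
      simp only [hξ]
      congr 1
      rw [← MonoidHom.comp_apply, ZMod.unitsMap_comp, ZMod.unitsMap_val]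
    have hB : sawSum χ' d = ∑ u, ξ u * g u := by
      rw [sawSum, sum_filter_coprime_eq_sum_units
        (fun u : ℕ => χ' (u : ZMod χ.conductor) * (saw ((u : ℝ) / d) : ℂ))]
      refine Finset.sum_congr rfl fun u _ => ?_
      simp only [hξ, hg, ZMod.unitsMap_val, ZMod.natCast_val]
    have hsum := sum_units_unitsMap hd (fun v => conj (ξ v) * ∑ u, g u * g (v * u))
    have hv : ∑ v, conj (ξ v) * ∑ u, g u * g (v * u) = (‖sawSum χ' d‖ : ℂ) ^ 2 := by
      -- Splitting `conj (ξ v)` as `ξ u * conj (ξ (v * u))` separates the variables `u` and `v * u`,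
      -- so the double sum is a product of conjugates.
      have h1 : ∀ v, conj (ξ v) * ∑ u, g u * g (v * u) =
          ∑ u, (ξ u * g u) * (conj (ξ (v * u)) * g (v * u)) := by
        intro v
        rw [Finset.mul_sum]
        refine Finset.sum_congr rfl fun u _ => ?_
        rw [hξmul, map_mul]
        linear_combination (-(conj (ξ v) * g u * g (v * u))) * hξone u
      simp only [h1]
      rw [Finset.sum_comm]
      have h2 : ∀ u, ∑ v, (ξ u * g u) * (conj (ξ (v * u)) * g (v * u)) =
          (ξ u * g u) * conj (sawSum χ' d) := by
        intro u
        rw [← Finset.mul_sum]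
        congr 1
        rw [hB, map_sum]
        refine Fintype.sum_equiv (Equiv.mulRight u) _ _ fun v => ?_
        rw [Equiv.coe_mulRight, map_mul]
        congr 1
        exact (Complex.conj_ofReal _).symm
      simp only [h2]
      rw [← Finset.sum_mul, ← hB, Complex.mul_conj, Complex.normSq_eq_norm_sq]
      push_cast
      rfl
    rw [hv] at hsum
    simp only [hχ]
    have hd0 : (d.totient : ℂ) ≠ 0 := by
      exact_mod_cast (Nat.totient_pos.2 (NeZero.pos d)).ne'
    rw [div_mul_eq_mul_div, eq_div_iff hd0, mul_comm, hsum]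
  -- Here some `k ≡ 1` modulo `d` has `χ k ≠ 1`. Translation by `k` fixes the Dedekind part and
  -- multiplies the sum by a factor different from `1`, so the sum vanishes.
  · have hnf : ¬ χ.FactorsThrough d := fun h =>
      hc (DirichletCharacter.conductor_dvd_of_mem_conductorSet χ h)
    rw [DirichletCharacter.factorsThrough_iff_ker_unitsMap hd, SetLike.not_le_iff_exists] at hnf
    obtain ⟨k, hk, hk'⟩ := hnf
    rw [MonoidHom.mem_ker] at hk hk'
    have hk1 : χ (k : ZMod q) ≠ 1 := fun h => hk' (Units.ext (by simpa using h))
    have hS := Fintype.sum_equiv (Equiv.mulRight k)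
      (fun a : (ZMod q)ˣ => conj (χ ((a * k : (ZMod q)ˣ) : ZMod q)) *
        ∑ u, g u * g (ZMod.unitsMap hd (a * k) * u))
      (fun a : (ZMod q)ˣ => conj (χ (a : ZMod q)) * ∑ u, g u * g (ZMod.unitsMap hd a * u))
      (fun a => rfl)
    simp only [Units.val_mul, map_mul, hk, mul_one] at hS
    simp only [mul_right_comm _ (conj (χ (k : ZMod q)))] at hS
    rw [← Finset.sum_mul] at hS
    have hk2 : conj (χ (k : ZMod q)) ≠ 1 := fun h => hk1 (by
      have := congrArg conj h
      simpa using this)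
    by_contra hne
    exact hk2 (mul_left_cancel₀ hne (hS.trans (mul_one _).symm))

lemma sum_range_mul_eq {M : Type*} [AddCommMonoid M] (F : ℕ → M) (c k : ℕ) :
    ∑ w ∈ Finset.range (c * k), F w = ∑ j ∈ Finset.range k, ∑ b ∈ Finset.range c, F (c * j + b) := by
  induction k with
  | zero => simp
  | succ k ih => rw [Nat.mul_succ, Finset.sum_range_add, ih, Finset.sum_range_succ]

/-- The character is constant on residue classes modulo `c`, and the distribution relation sums the
sawtooth over each class. -/
lemma sum_range_mul_saw {c : ℕ} (hc : 0 < c) (χ : DirichletCharacter ℂ c) {k : ℕ} (hk : 0 < k) :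
    ∑ w ∈ Finset.range (c * k), χ (w : ZMod c) * (saw ((w : ℝ) / (c * k : ℕ)) : ℂ) =
      ∑ b ∈ Finset.range c, χ (b : ZMod c) * (saw ((b : ℝ) / c) : ℂ) := by
  rw [sum_range_mul_eq, Finset.sum_comm]
  refine Finset.sum_congr rfl fun b _ => ?_
  have hc' : (c : ℝ) ≠ 0 := by positivity
  have hk' : (k : ℝ) ≠ 0 := by positivity
  have h1 : ∀ j : ℕ, χ ((c * j + b : ℕ) : ZMod c) * (saw (((c * j + b : ℕ) : ℝ) / (c * k : ℕ)) : ℂ) =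
      χ (b : ZMod c) * (saw ((b : ℝ) / (c * k) + j / k) : ℂ) := by
    intro j
    congr 2
    · simp
    · congr 1
      push_cast
      field_simp
      ring
  simp only [h1]
  rw [← Finset.mul_sum]
  congr 1
  have := sum_saw_add_div k hk ((b : ℝ) / (c * k))
  rw [show (k : ℝ) * ((b : ℝ) / (c * k)) = b / c by field_simp] at this
  rw [← this]
  push_cast
  rfl

open ArithmeticFunction in
lemma sum_divisors_moebius_dvd {d u : ℕ} (hd : 0 < d) :
    ∑ e ∈ d.divisors, (if e ∣ u then (moebius e : ℂ) else 0) = if Nat.Coprime u d then 1 else 0 := by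
  rw [← Finset.sum_filter]
  have hset : d.divisors.filter (· ∣ u) = (u.gcd d).divisors := by
    ext e
    simp only [Finset.mem_filter, Nat.mem_divisors, Nat.dvd_gcd_iff]
    have : u.gcd d ≠ 0 := (Nat.gcd_pos_of_pos_right _ hd).ne'
    have := hd.ne'
    tauto
  rw [hset]
  have h := congrArg (fun f : ArithmeticFunction ℂ => f (u.gcd d))
    (coe_moebius_mul_coe_zeta (R := ℂ))
  simp only [coe_mul_zeta_apply, one_apply] at h
  simpa [Nat.Coprime] using h

open ArithmeticFunction in
/-- The Euler factors of an imprimitive character. -/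
def eulerFactor {c : ℕ} (χ : DirichletCharacter ℂ c) (d : ℕ) : ℂ :=
  ∑ e ∈ d.divisors, (moebius e : ℂ) * χ (e : ZMod c)

/-- Möbius inversion removes the coprimality condition; the multiples `u = e w` contribute `μ(e)
χ(e)` times a sum modulo `d / e`. If `e` is coprime to `c`, then `c ∣ d / e` and that sum does not
depend on `e`; otherwise `χ(e) = 0`. -/
lemma sawSum_eq {c : ℕ} (hc : 0 < c) (χ : DirichletCharacter ℂ c) {d : ℕ} (hd : 0 < d)
    (hcd : c ∣ d) :
    sawSum χ d = eulerFactor χ d *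
      ∑ b ∈ Finset.range c, χ (b : ZMod c) * (saw ((b : ℝ) / c) : ℂ) := by
  rw [sawSum, Finset.sum_filter]
  have h1 : ∀ u ∈ Finset.range d,
      (if Nat.Coprime u d then χ (u : ZMod c) * (saw ((u : ℝ) / d) : ℂ) else 0) =
      ∑ e ∈ d.divisors, (ArithmeticFunction.moebius e : ℂ) *
        (if e ∣ u then χ (u : ZMod c) * (saw ((u : ℝ) / d) : ℂ) else 0) := by
    intro u _
    have := sum_divisors_moebius_dvd (u := u) hd
    calc _ = (if Nat.Coprime u d then 1 else 0) * (χ (u : ZMod c) * (saw ((u : ℝ) / d) : ℂ)) := by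
            split_ifs <;> simp
      _ = _ := by
        rw [← this, Finset.sum_mul]
        refine Finset.sum_congr rfl fun e _ => ?_
        split_ifs <;> simp
  rw [Finset.sum_congr rfl h1, Finset.sum_comm, eulerFactor, Finset.sum_mul]
  refine Finset.sum_congr rfl fun e he => ?_
  obtain ⟨k, rfl⟩ := Nat.dvd_of_mem_divisors he
  have he0 : 0 < e := Nat.pos_of_mul_pos_right hd
  have hk0 : 0 < k := Nat.pos_of_mul_pos_left hd
  rw [← Finset.mul_sum, mul_assoc]
  congr 1
  have heR : (e : ℝ) ≠ 0 := by positivity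
  have h2 : ∑ u ∈ Finset.range (e * k),
      (if e ∣ u then χ (u : ZMod c) * (saw ((u : ℝ) / (e * k : ℕ)) : ℂ) else 0) =
      χ (e : ZMod c) * ∑ w ∈ Finset.range k, χ (w : ZMod c) * (saw ((w : ℝ) / k) : ℂ) := by
    rw [sum_range_mul_eq, Finset.mul_sum]
    refine Finset.sum_congr rfl fun w _ => ?_
    rw [Finset.sum_eq_single_of_mem 0 (Finset.mem_range.2 he0)]
    · rw [add_zero, if_pos (dvd_mul_right e w), ← mul_assoc, ← map_mul]
      congr 2
      · push_cast; rfl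
      · congr 1
        push_cast
        field_simp
    · intro b hb hb0
      rw [if_neg]
      rw [Nat.dvd_add_right (dvd_mul_right e w)]
      exact Nat.not_dvd_of_pos_of_lt (Nat.pos_of_ne_zero hb0) (Finset.mem_range.1 hb)
  rw [h2]
  by_cases hcop : Nat.Coprime e c
  · have : c ∣ k := hcop.symm.dvd_of_dvd_mul_left hcd
    obtain ⟨l, rfl⟩ := this
    rw [sum_range_mul_saw hc χ (Nat.pos_of_mul_pos_left hk0)]
  · have : χ (e : ZMod c) = 0 := by
      refine χ.map_nonunit fun h => hcop ((ZMod.isUnit_iff_coprime e c).1 h)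
    rw [this, zero_mul, zero_mul]

/-- The twisted sum of Dedekind sums. -/
theorem sum_conj_mul_dedekindSum {q m : ℕ} [NeZero q] (hm : m ∣ q) (χ : DirichletCharacter ℂ q) :
    ∑ a : (ZMod q)ˣ, conj (χ (a : ZMod q)) * (dedekindSum (a : ZMod q).val m : ℂ) =
      (∑ d ∈ m.divisors.filter (χ.conductor ∣ ·), (q.totient : ℂ) / d.totient *
        (‖eulerFactor χ.primitiveCharacter d‖ : ℂ) ^ 2) *
      (‖∑ b ∈ Finset.range χ.conductor, χ.primitiveCharacter (b : ZMod χ.conductor) *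
        (saw ((b : ℝ) / χ.conductor) : ℂ)‖ : ℂ) ^ 2 := by
  have hm0 : 0 < m := Nat.pos_of_dvd_of_pos hm (NeZero.pos q)
  have e : ∀ a : (ZMod q)ˣ, conj (χ (a : ZMod q)) * (dedekindSum (a : ZMod q).val m : ℂ) =
      ∑ d ∈ m.divisors, conj (χ (a : ZMod q)) *
        (primitiveDedekindSum (a : ZMod q).val d : ℂ) := by
    intro a
    rw [dedekindSum_eq_sum_divisors _ hm0, ← Finset.mul_sum]
    push_cast
    rfl
  simp only [e]
  rw [Finset.sum_comm, Finset.sum_mul, Finset.sum_filter]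
  refine Finset.sum_congr rfl fun d hd => ?_
  have hdm := Nat.dvd_of_mem_divisors hd
  have hd0 : 0 < d := Nat.pos_of_dvd_of_pos hdm hm0
  have : NeZero d := ⟨hd0.ne'⟩
  rw [sum_conj_mul_primitiveDedekindSum (hdm.trans hm) χ]
  split_ifs with hc
  · rw [sawSum_eq (NeZero.pos _) _ hd0 hc, norm_mul]
    push_cast
    ring
  · rfl

end EisHom

end

noncomputable section

namespace EisHom

/-! ## The local weight as an Euler product -/

open ArithmeticFunction

/-- The arithmetic function `μ χ`. -/
def moebiusTwist {c : ℕ} (χ : DirichletCharacter ℂ c) : ArithmeticFunction ℂ :=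
  ⟨fun n => (moebius n : ℂ) * χ (n : ZMod c), by simp⟩

/-- The arithmetic function `σ₁` with complex values. -/
def sigmaOne : ArithmeticFunction ℂ := ((sigma 1 : ArithmeticFunction ℕ) : ArithmeticFunction ℂ)

lemma moebiusTwist_apply {c : ℕ} (χ : DirichletCharacter ℂ c) (n : ℕ) :
    moebiusTwist χ n = (moebius n : ℂ) * χ (n : ZMod c) := rfl

lemma sigmaOne_apply (n : ℕ) : sigmaOne n = (sigma 1 n : ℂ) := by
  simp [sigmaOne, natCoe_apply]

lemma isMultiplicative_moebiusTwist {c : ℕ} (χ : DirichletCharacter ℂ c) :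
    (moebiusTwist χ).IsMultiplicative := by
  refine ⟨by simp [moebiusTwist_apply], fun {m n} h => ?_⟩
  rw [moebiusTwist_apply, moebiusTwist_apply, moebiusTwist_apply,
    isMultiplicative_moebius.map_mul_of_coprime h]
  push_cast
  rw [map_mul]
  ring

lemma isMultiplicative_sigmaOne : sigmaOne.IsMultiplicative :=
  isMultiplicative_sigma.natCast

lemma moebiusTwist_inv_apply {c : ℕ} (χ : DirichletCharacter ℂ c) (n : ℕ) :
    moebiusTwist χ⁻¹ n = (moebius n : ℂ) * conj (χ (n : ZMod c)) := by
  rw [moebiusTwist_apply, ← MulChar.star_apply']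
  rfl

/-- At `s = 1/2` and `ℓ = 1` all gcds are `1`, the power of `d 1` is trivial, and that of `d 2`
cancels the square root in the eigenvalue. A triple Dirichlet convolution remains. -/
lemma eisensteinWeight_eq {c : ℕ} (χ : DirichletCharacter ℂ c) (n : ℕ) :
    eisensteinWeight χ n = (moebiusTwist χ⁻¹ * (moebiusTwist χ * sigmaOne)) n := by
  have hterm : ∀ d ∈ Nat.finMulAntidiag 3 n,
      (moebius (d 0) : ℂ) * conj (χ (d 0 : ZMod c)) *
      (d 1 : ℂ) ^ (1 - 2 * (1 / 2 : ℂ)) * (1 : DirichletCharacter ℂ 1) (d 1 : ZMod 1) *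
      moebius (d 1) * χ (d 1 : ZMod c) *
      (d 2 : ℂ) ^ (1 - (1 / 2 : ℂ)) * eisensteinEigenvalue (d 2 / (d 2).gcd 1) *
      ((d 2).gcd 1 : ℂ) ^ (1 / 2 : ℂ) * χ ((1 / (d 2).gcd 1 : ℕ) : ZMod c) =
      moebiusTwist χ⁻¹ (d 0) * (moebiusTwist χ (d 1) * sigmaOne (d 2)) := by
    intro d hd
    have h2 : (d 2 : ℂ) ≠ 0 := by exact_mod_cast Nat.ne_zero_of_mem_finMulAntidiag hd 2
    have e1 : (1 : DirichletCharacter ℂ 1) (d 1 : ZMod 1) = 1 :=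
      MulChar.one_apply (isUnit_of_subsingleton _)
    have e2 : (1 : ℂ) - 2 * (1 / 2) = 0 := by norm_num
    have e3 : (1 : ℂ) - 1 / 2 = 1 / 2 := by norm_num
    have e4 : (d 2 : ℂ) ^ (1 / 2 : ℂ) ≠ 0 := by simp [Complex.cpow_eq_zero_iff, h2]
    rw [moebiusTwist_inv_apply, moebiusTwist_apply, sigmaOne_apply, e1, e2, e3, Complex.cpow_zero,
      Nat.gcd_one_right, Nat.div_one, eisensteinEigenvalue]
    simp only [Nat.cast_one, Complex.one_cpow, map_one, Nat.div_one]
    field_simp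
  rw [eisensteinWeight, localWeight, Finset.filter_true_of_mem (fun d _ => by simp)]
  simp only [mul_apply, Finset.mul_sum, Finset.sum_sigma']
  rw [Finset.sum_congr rfl hterm]
  refine Finset.sum_bij' (fun d _ => ⟨(d 0, d 1 * d 2), (d 1, d 2)⟩)
    (fun x _ => ![x.1.1, x.2.1, x.2.2]) ?_ ?_ ?_ ?_ ?_
  · intro d hd
    have h3 := Nat.finMulAntidiag_three d hd
    have hn : n ≠ 0 := (Nat.mem_finMulAntidiag.1 hd).2
    have h12 : d 1 * d 2 ≠ 0 := mul_ne_zero (Nat.ne_zero_of_mem_finMulAntidiag hd 1)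
      (Nat.ne_zero_of_mem_finMulAntidiag hd 2)
    simp only [Finset.mem_sigma, Nat.mem_divisorsAntidiagonal]
    refine ⟨⟨by rw [← h3, mul_assoc], hn⟩, ?_⟩
    exact ⟨trivial, h12⟩
  · rintro ⟨⟨x, y⟩, ⟨u, v⟩⟩ h
    simp only [Finset.mem_sigma, Nat.mem_divisorsAntidiagonal] at h
    obtain ⟨⟨h1, h2⟩, h3, -⟩ := h
    rw [Nat.mem_finMulAntidiag]
    refine ⟨?_, h2⟩
    rw [Fin.prod_univ_three]
    simp [mul_assoc, h3, h1]
  · intro d _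
    ext i
    fin_cases i <;> rfl
  · rintro ⟨⟨x, y⟩, ⟨u, v⟩⟩ h
    simp only [Finset.mem_sigma, Nat.mem_divisorsAntidiagonal] at h
    obtain ⟨-, rfl, -⟩ := h
    rfl
  · intro d _
    rfl

variable {c : ℕ}

lemma eulerFactor_eq (χ : DirichletCharacter ℂ c) (n : ℕ) :
    eulerFactor χ n = (moebiusTwist χ * (zeta : ArithmeticFunction ℂ)) n := by
  rw [coe_mul_zeta_apply]
  rfl

/-- A divisor `e` of `c n` with `χ(e) ≠ 0` is coprime to `c`, hence divides `n`. -/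
lemma eulerFactor_mul_left (χ : DirichletCharacter ℂ c) (hc : 0 < c) {n : ℕ} (hn : 0 < n) :
    eulerFactor χ (c * n) = eulerFactor χ n := by
  symm
  refine Finset.sum_subset
    (Nat.divisors_subset_of_dvd (Nat.mul_pos hc hn).ne' (dvd_mul_left n c)) fun e he he' => ?_
  have : χ (e : ZMod c) = 0 := by
    refine χ.map_nonunit fun h => he' ?_
    have hcop := (ZMod.isUnit_iff_coprime e c).1 h
    exact Nat.mem_divisors.2 ⟨hcop.dvd_of_dvd_mul_left (Nat.dvd_of_mem_divisors he), hn.ne'⟩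
  rw [this, mul_zero]

/-- The arithmetic function `|∏_{p ∣ n} (1 - χ(p))|²`. -/
def eulerNorm (χ : DirichletCharacter ℂ c) : ArithmeticFunction ℂ :=
  ⟨fun n => (‖eulerFactor χ n‖ : ℂ) ^ 2, by simp [eulerFactor]⟩

/-- The arithmetic function `φ(c n) / φ(c)`. -/
def totientRatio (c : ℕ) : ArithmeticFunction ℂ :=
  ⟨fun n => (Nat.totient (c * n) : ℂ) / Nat.totient c, by simp⟩

lemma eulerNorm_apply (χ : DirichletCharacter ℂ c) (n : ℕ) :
    eulerNorm χ n = (‖eulerFactor χ n‖ : ℂ) ^ 2 := rfl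

lemma totientRatio_apply (c n : ℕ) :
    totientRatio c n = (Nat.totient (c * n) : ℂ) / Nat.totient c := rfl

lemma isMultiplicative_eulerNorm (χ : DirichletCharacter ℂ c) :
    (eulerNorm χ).IsMultiplicative := by
  have h : (moebiusTwist χ * (zeta : ArithmeticFunction ℂ)).IsMultiplicative :=
    (isMultiplicative_moebiusTwist χ).mul isMultiplicative_zeta.natCast
  refine ⟨?_, fun {m n} hmn => ?_⟩
  · rw [eulerNorm_apply, eulerFactor_eq, h.map_one]
    simp
  · simp only [eulerNorm_apply, eulerFactor_eq, h.map_mul_of_coprime hmn, norm_mul]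
    push_cast
    ring

lemma totient_cast_ne_zero {c : ℕ} (hc : 0 < c) : (Nat.totient c : ℂ) ≠ 0 := by
  exact_mod_cast (Nat.totient_pos.2 hc).ne'

lemma totientRatio_ne_zero (hc : 0 < c) {n : ℕ} (hn : 0 < n) : totientRatio c n ≠ 0 :=
  div_ne_zero (totient_cast_ne_zero (Nat.mul_pos hc hn)) (totient_cast_ne_zero hc)

/-- The identity `φ(gcd(x, y)) φ(x y) = φ(x) φ(y) gcd(x, y)` is used for the pairs `(c m, c n)` and
`(c, c m n)`, which have the same product and the same gcd `c`. -/
lemma isMultiplicative_totientRatio (hc : 0 < c) : (totientRatio c).IsMultiplicative := by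
  refine ⟨?_, fun {m n} hmn => ?_⟩
  · rw [totientRatio_apply, mul_one, div_self (totient_cast_ne_zero hc)]
  · have h1 := Nat.totient_gcd_mul_totient_mul (c * m) (c * n)
    rw [Nat.gcd_mul_left, hmn.gcd_eq_one, mul_one] at h1
    have h2 := Nat.totient_gcd_mul_totient_mul c (c * (m * n))
    rw [Nat.gcd_eq_left (dvd_mul_right _ _)] at h2
    have e : c * m * (c * n) = c * (c * (m * n)) := by ring
    rw [e, h2] at h1
    have h3 : Nat.totient c * Nat.totient (c * (m * n)) =
        Nat.totient (c * m) * Nat.totient (c * n) := Nat.eq_of_mul_eq_mul_right hc h1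
    have h3C : (Nat.totient c : ℂ) * Nat.totient (c * (m * n)) =
        Nat.totient (c * m) * Nat.totient (c * n) := by exact_mod_cast h3
    have := totient_cast_ne_zero hc
    simp only [totientRatio_apply]
    field_simp
    linear_combination h3C

lemma mul_apply_prime_pow {p : ℕ} (hp : p.Prime) (f g : ArithmeticFunction ℂ) (k : ℕ) :
    (f * g) (p ^ k) = ∑ i ∈ Finset.range (k + 1), f (p ^ i) * g (p ^ (k - i)) := by
  rw [mul_apply, Nat.sum_divisorsAntidiagonal (fun a b => f a * g b),
    Nat.divisors_prime_pow hp, Finset.sum_map]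
  refine Finset.sum_congr rfl fun i hi => ?_
  simp only [Function.Embedding.coeFn_mk]
  rw [Nat.pow_div (by have := Finset.mem_range.1 hi; omega) hp.pos]

lemma moebiusTwist_mul_prime_pow {p : ℕ} (hp : p.Prime) (χ : DirichletCharacter ℂ c)
    (g : ArithmeticFunction ℂ) (k : ℕ) :
    (moebiusTwist χ * g) (p ^ (k + 1)) = g (p ^ (k + 1)) - χ (p : ZMod c) * g (p ^ k) := by
  rw [mul_apply_prime_pow hp, Finset.sum_range_succ', Finset.sum_range_succ']
  have h0 : ∀ i ∈ Finset.range k, moebiusTwist χ (p ^ (i + 1 + 1)) *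
      g (p ^ (k + 1 - (i + 1 + 1))) = 0 := by
    intro i _
    rw [moebiusTwist_apply, moebius_apply_prime_pow hp (by omega), if_neg (by omega)]
    simp
  rw [Finset.sum_eq_zero h0, zero_add, zero_add, pow_one, pow_zero,
    (isMultiplicative_moebiusTwist χ).map_one, moebiusTwist_apply, moebius_apply_prime hp]
  simp
  ring

/-- The divisor sum of `φ(c m) / φ(c δ) · |∏_{p ∣ δ} (1 - χ(p))|²`. -/
def totientSum (χ : DirichletCharacter ℂ c) : ArithmeticFunction ℂ :=
  (totientRatio c).pmul (((eulerNorm χ).pdiv (totientRatio c)) * (zeta : ArithmeticFunction ℂ))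

lemma totientSum_apply (χ : DirichletCharacter ℂ c) (n : ℕ) :
    totientSum χ n = ∑ d ∈ n.divisors, totientRatio c n / totientRatio c d * eulerNorm χ d := by
  rw [totientSum, pmul_apply, coe_mul_zeta_apply, Finset.mul_sum]
  refine Finset.sum_congr rfl fun d _ => ?_
  rw [pdiv_apply]
  ring

lemma isMultiplicative_totientSum (hc : 0 < c) (χ : DirichletCharacter ℂ c) :
    (totientSum χ).IsMultiplicative :=
  (isMultiplicative_totientRatio hc).pmul
    (((isMultiplicative_eulerNorm χ).pdiv (isMultiplicative_totientRatio hc)).mul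
      isMultiplicative_zeta.natCast)

lemma eulerNorm_prime_pow {p : ℕ} (hp : p.Prime) (χ : DirichletCharacter ℂ c) (k : ℕ) :
    eulerNorm χ (p ^ (k + 1)) = (‖χ (p : ZMod c) - 1‖ : ℂ) ^ 2 := by
  rw [eulerNorm_apply, eulerFactor_eq, moebiusTwist_mul_prime_pow hp, norm_sub_rev]
  have h : ∀ j : ℕ, (zeta : ArithmeticFunction ℂ) (p ^ j) = 1 := fun j => by
    rw [natCoe_apply, zeta_apply_ne (pow_ne_zero _ hp.ne_zero), Nat.cast_one]
  rw [h, h, mul_one]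

lemma totientSum_prime_pow_succ (hc : 0 < c) {p : ℕ} (hp : p.Prime) (χ : DirichletCharacter ℂ c)
    (k : ℕ) : totientSum χ (p ^ (k + 1)) =
      totientRatio c (p ^ (k + 1)) / totientRatio c (p ^ k) * totientSum χ (p ^ k) +
        (‖χ (p : ZMod c) - 1‖ : ℂ) ^ 2 := by
  have h1 := totientRatio_ne_zero hc (pow_pos hp.pos k)
  have h2 := totientRatio_ne_zero hc (pow_pos hp.pos (k + 1))
  rw [totientSum_apply, totientSum_apply, Nat.divisors_prime_pow hp, Finset.sum_map,
    Nat.divisors_prime_pow hp, Finset.sum_map, Finset.sum_range_succ, Finset.mul_sum]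
  congr 1
  · refine Finset.sum_congr rfl fun i _ => ?_
    field_simp
  · simp only [Function.Embedding.coeFn_mk]
    rw [div_self h2, one_mul, eulerNorm_prime_pow hp]

lemma totientRatio_div {p : ℕ} (hp : p.Prime) (hc : 0 < c) (k : ℕ) :
    totientRatio c (p ^ (k + 1)) / totientRatio c (p ^ k) =
      if p ∣ c * p ^ k then (p : ℂ) else p - 1 := by
  have h1 := totient_cast_ne_zero hc
  have h2 := totient_cast_ne_zero (Nat.mul_pos hc (pow_pos hp.pos k))
  rw [totientRatio_apply, totientRatio_apply, div_div_div_cancel_right₀ h1, div_eq_iff h2]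
  have e : c * p ^ (k + 1) = p * (c * p ^ k) := by ring
  rw [e]
  split_ifs with h
  · rw [Nat.totient_mul_of_prime_of_dvd hp h]
    push_cast
    ring
  · rw [Nat.totient_mul_of_prime_of_not_dvd hp h, Nat.cast_mul, Nat.cast_sub hp.one_le]
    push_cast
    ring

lemma sigmaOne_prime_pow_succ {p : ℕ} (hp : p.Prime) (k : ℕ) :
    sigmaOne (p ^ (k + 1)) = p * sigmaOne (p ^ k) + 1 := by
  rw [sigmaOne_apply, sigmaOne_apply, sigma_one_apply_prime_pow hp, sigma_one_apply_prime_pow hp,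
    Finset.sum_range_succ']
  push_cast
  rw [Finset.mul_sum, pow_zero]
  congr 1
  exact Finset.sum_congr rfl fun i _ => by ring

/-- Both sides are multiplicative, so prime powers suffice. With `x = χ(p)`, both satisfy `F (k + 1)
= p F k + |x - 1| ^ 2` for `k ≥ 1`. At `k = 0` the totient ratio is `p - 1` when `p ∤ c`, which `|x|
= 1` compensates. -/
theorem totientSum_eq (hc : 0 < c) (χ : DirichletCharacter ℂ c) :
    totientSum χ = moebiusTwist χ⁻¹ * (moebiusTwist χ * sigmaOne) := by
  have hm2 := (isMultiplicative_moebiusTwist χ).mul isMultiplicative_sigmaOne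
  have hm := (isMultiplicative_moebiusTwist χ⁻¹).mul hm2
  rw [(isMultiplicative_totientSum hc χ).eq_iff_eq_on_prime_powers _ _ hm]
  intro p k hp
  set x := χ (p : ZMod c) with hx
  have hxi : χ⁻¹ (p : ZMod c) = conj x := by
    rw [← MulChar.star_apply']; rfl
  have hnorm : (‖x - 1‖ : ℂ) ^ 2 = x * conj x - x - conj x + 1 := by
    have := Complex.mul_conj (x - 1)
    rw [Complex.normSq_eq_norm_sq] at this
    push_cast at this
    rw [← this, map_sub, map_one]
    ring
  have hcase : p ∣ c ∧ x = 0 ∨ ¬ p ∣ c ∧ x * conj x = 1 := by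
    by_cases h : p ∣ c
    · refine Or.inl ⟨h, χ.map_nonunit fun hu => ?_⟩
      exact (hp.coprime_iff_not_dvd.1 ((ZMod.isUnit_iff_coprime p c).1 hu)) h
    · refine Or.inr ⟨h, ?_⟩
      have hu := (ZMod.isUnit_iff_coprime p c).2 (hp.coprime_iff_not_dvd.2 h)
      rw [hx, ← hu.unit_spec, Complex.mul_conj, Complex.normSq_eq_norm_sq, χ.unit_norm_eq_one]
      simp
  have hs0 : sigmaOne (p ^ 0) = 1 := by
    rw [pow_zero]; exact isMultiplicative_sigmaOne.map_one
  have ht0 : (moebiusTwist χ * sigmaOne) (p ^ 0) = 1 := by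
    rw [pow_zero]; exact hm2.map_one
  induction k with
  | zero => rw [pow_zero, (isMultiplicative_totientSum hc χ).map_one, hm.map_one]
  | succ k ih =>
    rw [totientSum_prime_pow_succ hc hp, ih, totientRatio_div hp hc, hnorm]
    -- Small exponents are separate: the totient ratio is exceptional at the first step, and the
    -- double Möbius twist reaches back two powers of `p`.
    cases k with
    | zero =>
      rw [moebiusTwist_mul_prime_pow hp, moebiusTwist_mul_prime_pow hp, hxi, ← hx, ht0,
        sigmaOne_prime_pow_succ hp, hs0, pow_zero, hm.map_one]
      rw [mul_one c]
      rcases hcase with ⟨h1, h2⟩ | ⟨h1, h2⟩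
      · rw [if_pos h1, h2]; simp
      · rw [if_neg h1]
        linear_combination h2
    | succ k =>
      have hdvd : p ∣ c * p ^ (k + 1) := Dvd.dvd.mul_left (dvd_pow_self p (by omega)) c
      rw [if_pos hdvd]
      rw [moebiusTwist_mul_prime_pow hp χ⁻¹ _ (k + 1), moebiusTwist_mul_prime_pow hp χ⁻¹ _ k, hxi,
        moebiusTwist_mul_prime_pow hp χ _ (k + 1), moebiusTwist_mul_prime_pow hp χ _ k, ← hx,
        sigmaOne_prime_pow_succ hp (k + 1)]
      cases k with
      | zero =>
        rw [ht0, sigmaOne_prime_pow_succ hp, hs0]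
        ring
      | succ k =>
        rw [moebiusTwist_mul_prime_pow hp χ _ k, ← hx, sigmaOne_prime_pow_succ hp (k + 1),
          sigmaOne_prime_pow_succ hp k]
        ring

/-- The evaluation of the divisor sum that comes from Dedekind sums. -/
theorem sum_sdiff_totient_mul_eulerFactor {N q : ℕ} (hN : N.Prime) (hq : 0 < q) (hNq : N ∣ q)
    (hcq : c ∣ q) (χ : DirichletCharacter ℂ c) :
    ∑ d ∈ q.divisors.filter (c ∣ ·) \ (q / N).divisors.filter (c ∣ ·),
      (q.totient : ℂ) / d.totient * (‖eulerFactor χ d‖ : ℂ) ^ 2 =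
    (‖χ (N : ZMod c) - 1‖ : ℂ) ^ 2 * eisensteinWeight χ (ordCompl[N] (q / c)) := by
  obtain ⟨m, rfl⟩ := hcq
  have hc : 0 < c := Nat.pos_of_mul_pos_right hq
  have hm : 0 < m := Nat.pos_of_mul_pos_left hq
  rw [Nat.mul_div_cancel_left _ hc]
  obtain ⟨k, m', hm', rfl⟩ := Nat.exists_eq_pow_mul_and_not_dvd hm.ne' N hN.ne_one
  have hm'0 : 0 < m' := Nat.pos_of_mul_pos_left hm
  have hNk : 0 < N ^ k := pow_pos hN.pos k
  have hord : ordCompl[N] (N ^ k * m') = m' := by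
    rw [Nat.factorization_mul hNk.ne' hm'0.ne', hN.factorization_pow]
    simp [Nat.factorization_eq_zero_of_not_dvd hm', Nat.mul_div_cancel_left _ hNk]
  rw [hord, eisensteinWeight_eq, ← totientSum_eq hc, totientSum_apply, Finset.mul_sum]
  have hcop : ∀ δ, δ ∣ m' → Nat.Coprime (N ^ k) δ := fun δ hδ =>
    Nat.Coprime.pow_left k ((hN.coprime_iff_not_dvd).2 fun h => hm' (h.trans hδ))
  -- For `k = 0` the hypothesis `N ∣ q` forces `N ∣ c`, so `χ(N) = 0` and both sides are `1`.
  have hnorm : eulerNorm χ (N ^ k) = (‖χ (N : ZMod c) - 1‖ : ℂ) ^ 2 := by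
    cases k with
    | zero =>
      have hNc : N ∣ c := by
        rw [pow_zero, one_mul] at hNq
        exact (hN.dvd_mul.1 hNq).resolve_right hm'
      have : χ (N : ZMod c) = 0 := χ.map_nonunit fun hu =>
        (hN.coprime_iff_not_dvd.1 ((ZMod.isUnit_iff_coprime N c).1 hu)) hNc
      rw [pow_zero, (isMultiplicative_eulerNorm χ).map_one, this]
      simp
    | succ k => exact eulerNorm_prime_pow hN χ k
  have hdivN : ∀ d, d ∣ c * (N ^ k * m') / N ↔ N * d ∣ c * (N ^ k * m') := fun d => by
    rw [Nat.dvd_div_iff_mul_dvd hNq]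
  symm
  -- A multiple `d` of `c` dividing `q` fails to divide `q / N` exactly when `d / c` contains the
  -- full power `N ^ k`.
  refine Finset.sum_bij (fun δ _ => c * (N ^ k * δ)) (fun δ hδ => ?_) (fun a ha b hb h => ?_)
    (fun d hd => ?_) (fun δ hδ => ?_)
  · have hδ' := Nat.dvd_of_mem_divisors hδ
    simp only [Finset.mem_sdiff, Finset.mem_filter, Nat.mem_divisors, hdivN, not_and]
    refine ⟨⟨⟨Nat.mul_dvd_mul_left _ (Nat.mul_dvd_mul_left _ hδ'), hq.ne'⟩,
      dvd_mul_right _ _⟩, ?_⟩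
    rintro ⟨h, -⟩
    refine absurd ?_ hm'
    have e : N * (c * (N ^ k * δ)) = c * (N ^ k * (N * δ)) := by ring
    rw [e] at h
    have := Nat.dvd_of_mul_dvd_mul_left hNk (Nat.dvd_of_mul_dvd_mul_left hc h)
    exact (dvd_mul_right N δ).trans this
  · exact Nat.eq_of_mul_eq_mul_left hNk (Nat.eq_of_mul_eq_mul_left hc h)
  · simp only [Finset.mem_sdiff, Finset.mem_filter, Nat.mem_divisors, hdivN, not_and] at hd
    obtain ⟨⟨⟨h1, h2⟩, δ, rfl⟩, h3⟩ := hd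
    have hδ := Nat.dvd_of_mul_dvd_mul_left hc h1
    obtain ⟨a, b, ha, hb, rfl⟩ := (Nat.dvd_mul).1 hδ
    obtain ⟨j, hj, rfl⟩ := (Nat.dvd_prime_pow hN).1 ha
    have hjk : j = k := by
      by_contra hne
      have hlt : j + 1 ≤ k := by omega
      refine h3 ⟨?_, (Nat.div_pos (Nat.le_of_dvd hq hNq) hN.pos).ne'⟩ (dvd_mul_right _ _)
      have e : N * (c * (N ^ j * b)) = c * (N ^ (j + 1) * b) := by ring
      rw [e]
      exact Nat.mul_dvd_mul_left _ (Nat.mul_dvd_mul (pow_dvd_pow _ hlt) hb)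
    subst hjk
    exact ⟨b, Nat.mem_divisors.2 ⟨hb, hm'0.ne'⟩, rfl⟩
  · have hδ' := Nat.dvd_of_mem_divisors hδ
    have hδ0 : 0 < δ := Nat.pos_of_dvd_of_pos hδ' hm'0
    have hNδ : 0 < N ^ k * δ := Nat.mul_pos hNk hδ0
    have hr := isMultiplicative_totientRatio hc
    have e1 : ((c * (N ^ k * m')).totient : ℂ) / (c * (N ^ k * δ)).totient =
        totientRatio c m' / totientRatio c δ := by
      have h0 := totientRatio_ne_zero hc hNk
      have h1 := totientRatio_ne_zero hc hδ0
      have h2 := totient_cast_ne_zero hc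
      rw [← div_div_div_cancel_right₀ h2, ← totientRatio_apply, ← totientRatio_apply,
        hr.map_mul_of_coprime (hcop _ dvd_rfl), hr.map_mul_of_coprime (hcop _ hδ'),
        mul_div_mul_left _ _ h0]
    rw [e1, eulerFactor_mul_left χ hc hNδ, ← eulerNorm_apply χ (N ^ k * δ),
      (isMultiplicative_eulerNorm χ).map_mul_of_coprime (hcop _ hδ'), hnorm]
    ring

end EisHom

end

noncomputable section

namespace EisHom

/-! ## The main theorem -/

/-- The substitution `a ↦ -a` changes the sign of the Dedekind sum and preserves an even character.
-/
lemma sum_conj_mul_dedekindSum_of_even {q : ℕ} [NeZero q] {m : ℕ} (hm : m ∣ q)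
    {χ : DirichletCharacter ℂ q} (hχ : χ.Even) :
    ∑ a : (ZMod q)ˣ, conj (χ (a : ZMod q)) * (dedekindSum (a : ZMod q).val m : ℂ) = 0 := by
  have h := Fintype.sum_equiv (Equiv.neg (ZMod q)ˣ)
    (fun a => conj (χ ((-a : (ZMod q)ˣ) : ZMod q)) *
      (dedekindSum ((-a : (ZMod q)ˣ) : ZMod q).val m : ℂ))
    (fun a => conj (χ (a : ZMod q)) * (dedekindSum (a : ZMod q).val m : ℂ)) (fun _ => rfl)
  have hs : ∀ a : (ZMod q)ˣ, dedekindSum ((-a : (ZMod q)ˣ) : ZMod q).val m =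
      -dedekindSum (a : ZMod q).val m := by
    intro a
    rw [← dedekindSum_neg]
    refine dedekindSum_congr (Int.ModEq.of_dvd (Int.natCast_dvd_natCast.2 hm) ?_)
    rw [← ZMod.intCast_eq_intCast_iff]
    push_cast
    rw [ZMod.natCast_zmod_val, ZMod.natCast_zmod_val]
  simp only [hs] at h
  simp only [Units.val_neg, hχ.eval_neg, Complex.ofReal_neg, mul_neg,
    Finset.sum_neg_distrib] at h
  linear_combination (-1 / 2 : ℂ) * h

lemma primitiveCharacter_odd {q : ℕ} {χ : DirichletCharacter ℂ q} (hχ : χ.Odd) :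
    χ.primitiveCharacter.Odd := by
  have h := χ.primitiveCharacter_apply_of_isCoprime (a := -1) (isCoprime_one_left.neg_left)
  have h' : χ (-1) = -1 := hχ
  push_cast at h
  exact h.trans h'

/-- The twisted sum of the Eisenstein periods in terms of Dedekind sums. -/
lemma sum_conj_mul_capPairing {N q : ℕ} [NeZero N] [NeZero q] (hN : 1 < N) (hNq : N ∣ q)
    (ψ : DoubleCosetEmbedding q) (χ : DirichletCharacter ℂ q) :
    ∑ a : (ZMod q)ˣ, conj (χ (a : ZMod q)) *
      capPairing (ψ.homologyClass hNq a) (eisensteinClass N) =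
    12 / (N - 1) * (∑ a : (ZMod q)ˣ, conj (χ (a : ZMod q)) * (dedekindSum (a : ZMod q).val q : ℂ) -
      ∑ a : (ZMod q)ˣ, conj (χ (a : ZMod q)) * (dedekindSum (a : ZMod q).val (q / N) : ℂ)) +
    ∑ a : (ZMod q)ˣ, conj (χ (a : ZMod q)) * ((normTrace (ψ.toFun a) : ℂ) / q) := by
  rw [← Finset.sum_sub_distrib, Finset.mul_sum, ← Finset.sum_add_distrib]
  refine Finset.sum_congr rfl fun a _ => ?_
  rw [capPairing_homologyClass hN hNq]
  push_cast
  ring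

end EisHom
end

theorem mainTheorem8 (N : ℕ) [Fact N.Prime] (hN : 3 ≤ N) (q : ℕ) [NeZero q] (hq : 2 ≤ q)
    (hNq : N ∣ q) (ψ : EisHom.DoubleCosetEmbedding q) (χ : DirichletCharacter ℂ q) :
    ∃ M : ℝ, 0 ≤ M ∧
      (M : ℂ) = (if χ = 1 then 0 else
        6 * (1 - χ (-1)) / (Real.pi : ℂ) ^ 2 *
          ((‖χ.primitiveCharacter (N : ZMod χ.conductor) - 1‖ : ℂ) ^ 2 / ((N : ℂ) - 1)) *
          (‖DirichletCharacter.LFunction χ.primitiveCharacter 1‖ : ℂ) ^ 2 *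
          (χ.conductor : ℂ) *
          EisHom.eisensteinWeight χ.primitiveCharacter (ordCompl[N] (q / χ.conductor))) ∧
      ∑ a : (ZMod q)ˣ, conj (χ (a : ZMod q)) *
          EisHom.capPairing (ψ.homologyClass hNq a) (EisHom.eisensteinClass N) =
        (M : ℂ) + ∑ a : (ZMod q)ˣ, conj (χ (a : ZMod q)) *
          ((EisHom.normTrace (ψ.toFun a) : ℂ) / q) := by
  have hp : N.Prime := Fact.out
  have hqN : q / N ∣ q := Nat.div_dvd_of_dvd hNq
  rcases χ.even_or_odd with he | ho
  -- The principal character is even, so it is covered here.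
  · refine ⟨0, le_rfl, ?_, ?_⟩
    · have h1 : χ (-1) = 1 := he
      rw [h1]
      simp
    · rw [EisHom.sum_conj_mul_capPairing hp.one_lt, EisHom.sum_conj_mul_dedekindSum_of_even dvd_rfl he,
        EisHom.sum_conj_mul_dedekindSum_of_even hqN he]
      simp
  · have hχ1 : χ ≠ 1 := by
      rintro rfl
      have h1 : (1 : DirichletCharacter ℂ q) (-1) = -1 := ho
      rw [MulChar.one_apply isUnit_one.neg] at h1
      norm_num at h1
    have hχm : χ (-1) = -1 := ho
    rw [if_neg hχ1, EisHom.sum_conj_mul_capPairing hp.one_lt, hχm,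
      EisHom.sum_conj_mul_dedekindSum dvd_rfl, EisHom.sum_conj_mul_dedekindSum hqN, ← sub_mul,
      ← Finset.sum_sdiff_eq_sub (Finset.filter_subset_filter _
        (Nat.divisors_subset_of_dvd (NeZero.ne q) hqN))]
    have hL := EisHom.norm_sum_mul_saw_sq χ.primitiveCharacter_isPrimitive
      (EisHom.primitiveCharacter_odd ho)
    have hS := EisHom.sum_sdiff_totient_mul_eulerFactor hp (NeZero.pos q) hNq
      χ.conductor_dvd_level χ.primitiveCharacter
    generalize ‖∑ b ∈ Finset.range χ.conductor, χ.primitiveCharacter (b : ZMod χ.conductor) *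
      (EisHom.saw ((b : ℝ) / χ.conductor) : ℂ)‖ = T at hL ⊢
    have hN1 : (0 : ℝ) < N - 1 := by
      have : (3 : ℝ) ≤ N := by exact_mod_cast hN
      linarith
    -- Nonnegativity is read off this sum of weighted absolute squares, since the sign of `ν` is not
    -- apparent from its definition.
    obtain ⟨S, hS0, hSC⟩ : ∃ S : ℝ, 0 ≤ S ∧ (S : ℂ) =
        ∑ d ∈ q.divisors.filter (χ.conductor ∣ ·) \ (q / N).divisors.filter (χ.conductor ∣ ·),
          (q.totient : ℂ) / d.totient * (‖EisHom.eulerFactor χ.primitiveCharacter d‖ : ℂ) ^ 2 := by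
      refine ⟨∑ d ∈ q.divisors.filter (χ.conductor ∣ ·) \
        (q / N).divisors.filter (χ.conductor ∣ ·), (q.totient : ℝ) / d.totient *
          ‖EisHom.eulerFactor χ.primitiveCharacter d‖ ^ 2,
        Finset.sum_nonneg fun d _ => mul_nonneg (by positivity) (sq_nonneg _), ?_⟩
      push_cast
      rfl
    rw [← hSC] at hS ⊢
    refine ⟨12 / (N - 1) * (S * T ^ 2),
      mul_nonneg (div_nonneg (by norm_num) hN1.le) (mul_nonneg hS0 (sq_nonneg T)), ?_, ?_⟩
    · have hL' : (T : ℂ) ^ 2 = χ.conductor *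
          (‖DirichletCharacter.LFunction χ.primitiveCharacter 1‖ : ℂ) ^ 2 / Real.pi ^ 2 := by
        have := congrArg (fun x : ℝ => (x : ℂ)) hL
        push_cast at this
        exact this
      push_cast
      rw [hS, hL']
      ring
    · push_cast
      rfl
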